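/- **Definitions.** A *hedonic diversity game* has a set $N=[n]$ of agents partitioned into nonempty color classes $D_1,\dots,D_\gamma$. The *palette* of a nonempty set $X\subseteq N$ is $\left(\frac{|D_c\cap X|}{|X|}\right)_{c\in[\gamma]}$. There is a set $M$ of weak orders (total preorders) over the set of all palettes of nonempty subsets of $N$, and every agent $i$ is assigned a weak order $\succeq_i\,\in M$ (not necessarily surjectively); the *number of agent types* is $\tau=|M|$. For nonempty $X,Y\subseteq N$ write $X\succeq_i Y$ if the palette of $X$ is $\succeq_i$ the palette of $Y$. An *outcome* is a partition $\Pi$ of $N$ into nonempty coalitions; $\Pi_i$ is the coalition containing $i$; a coalition is *trivial* if it has exactly one member. Agent $i$ has an *NS-deviation* to $C\in\Pi\cup\{\emptyset\}$ if $C\cup\{i\}\succ_i\Pi_i$; this is an *IS-deviation* if moreover $C\cup\{i\}\succeq_j C$ for every $j\in C$. An outcome is *Nash stable* (*individually stable*) if no agent has an NS-deviation (IS-deviation). The problem HDG-Nash (HDG-Individual): given the agents and their colors, integers $\sigma,\rho_{\ge1},\rho_{\ge2}$, and an oracle that compares any two nonempty coalitions according to $\succeq_i$ for each agent $i$, decide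 whether there is a Nash stable (individually stable) outcome with at most $\rho_{\ge1}$ coalitions, of which at most $\rho_{\ge2}$ are non-trivial, and all of size at most $\sigma$. Such a problem, given by an oracle, is called *NP-hard* on a class of instances if for every $L\in\mathrm{NP}$ there is a map $x\mapsto F(x)$ from binary words to instances in the class such that $x\in L$ if and only if $F(x)$ is a yes-instance, the explicit part of $F(x)$ (agents, colors, integers) is computable from $x$ in polynomial time, and the answers of the preference oracle of $F(x)$ are computable from $x$ and the query in time polynomial in the lengths of $x$ and the query. **Theorem.** HDG-Nash is NP-hard even when restricted to instances with $\tau=\rho_{\ge2}=2$ and $\rho_{\ge1}=3$. HDG-Individual is NP-hard even when restricted to instances with $\tau=4$ and $\rho_{\ge1}=\rho_{\ge2}=3$. -/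

import Mathlib

/-! ### Polynomial time and NP

Polynomial-time computability is Mathlib's `Turing.TM2ComputableInPolyTime`, relative to explicit
encodings of the arguments and of the values as finite words. -/

/-- Encoding of a pair of binary words: the first word, a separator, the second word. -/
def encodePair (p : List Bool × List Bool) : List (Option Bool) :=
  p.1.map some ++ none :: p.2.map some

/-- The class NP of languages of binary words, defined by polynomial-time verifiers and
certificates of polynomially bounded length. -/
def InNP (L : Set (List Bool)) : Prop :=
  ∃ (p : Polynomial ℕ) (V : List Bool × List Bool → Bool),
    Nonempty (Turing.TM2ComputableInPolyTime encodePair (fun b : Bool => [b]) V) ∧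
    ∀ x, x ∈ L ↔ ∃ w : List Bool, w.length ≤ p.eval x.length ∧ V (x, w) = true

/-! ### Hedonic diversity games -/

/-- The palette of a set `X` of agents: for each color `c`, the fraction `|D_c ∩ X| / |X|`, where
`D_c` is the set of agents of color `c`. It is used only for nonempty `X`. -/
def palette {n γ : ℕ} (color : Fin n → Fin γ) (X : Finset (Fin n)) : Fin γ → ℚ :=
  fun c => ((X.filter fun i => color i = c).card : ℚ) / (X.card : ℚ)

/-- The set of all palettes of nonempty sets of agents, as a type. -/
def PaletteOf {n γ : ℕ} (color : Fin n → Fin γ) : Type :=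
  {p : Fin γ → ℚ // ∃ X : Finset (Fin n), X.Nonempty ∧ palette color X = p}

/-- A weak order (total preorder) on `α`; `rel p q` reads "`p` is at least as good as `q`". -/
@[ext]
structure WeakOrder (α : Type) where
  rel : α → α → Prop
  total : ∀ p q, rel p q ∨ rel q p
  trans : ∀ p q r, rel p q → rel q r → rel p r

/-- An instance: agents `Fin n` partitioned into `γ` (nonempty) color classes, a set `M` of weak
orders over the set of all palettes, a (not necessarily surjective) assignment of a member of `M`
to each agent, and the integers bounding the size of coalitions, the number of coalitions and the
number of non-trivial coalitions. -/
structure HDGInstance where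
  n : ℕ
  γ : ℕ
  color : Fin n → Fin γ
  color_surjective : Function.Surjective color
  M : Set (WeakOrder (PaletteOf color))
  pref : Fin n → WeakOrder (PaletteOf color)
  pref_mem : ∀ i, pref i ∈ M
  /-- maximum size of a coalition -/
  maxSize : ℕ
  /-- maximum number of coalitions -/
  maxCoalitions : ℕ
  /-- maximum number of non-trivial coalitions -/
  maxNontrivial : ℕ

namespace HDGInstance

variable (I : HDGInstance)

/-- The number of agent types. -/
noncomputable def numTypes : ℕ := I.M.ncard

/-- A nonempty set of agents. -/
abbrev Coalition : Type := {C : Finset (Fin I.n) // C.Nonempty}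

/-- The palette of a coalition. -/
def pal (C : I.Coalition) : PaletteOf I.color := ⟨palette I.color C.1, C.1, C.2, rfl⟩

/-- Agent `i` weakly prefers `C` to `D`. -/
def WeakPref (i : Fin I.n) (C D : I.Coalition) : Prop := (I.pref i).rel (I.pal C) (I.pal D)

/-- Agent `i` strictly prefers `C` to `D`. -/
def StrictPref (i : Fin I.n) (C D : I.Coalition) : Prop := I.WeakPref i C D ∧ ¬ I.WeakPref i D C

/-- An outcome: a partition of the set of agents into nonempty coalitions. -/
abbrev Outcome : Type := Finpartition (Finset.univ : Finset (Fin I.n))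

/-- The coalition `C ∪ {i}`. -/
def join (i : Fin I.n) (C : Finset (Fin I.n)) : I.Coalition :=
  ⟨insert i C, Finset.insert_nonempty i C⟩

/-- The coalition of agent `i` in the outcome `P`. -/
def coalitionOf (P : I.Outcome) (i : Fin I.n) : I.Coalition :=
  ⟨P.part i, ⟨i, P.mem_part (Finset.mem_univ i)⟩⟩

/-- Agent `i` admits an NS-deviation from `P` to `C`, where `C` is a coalition of `P` or empty. -/
def NSDeviation (P : I.Outcome) (i : Fin I.n) (C : Finset (Fin I.n)) : Prop :=
  (C ∈ P.parts ∨ C = ∅) ∧ I.StrictPref i (I.join i C) (I.coalitionOf P i)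

/-- An NS-deviation that every member `j` of the joined coalition `C` weakly welcomes. -/
def ISDeviation (P : I.Outcome) (i : Fin I.n) (C : Finset (Fin I.n)) : Prop :=
  I.NSDeviation P i C ∧ ∀ (j : Fin I.n) (hj : j ∈ C), I.WeakPref j (I.join i C) ⟨C, ⟨j, hj⟩⟩

/-- Nash stability. -/
def NashStable (P : I.Outcome) : Prop := ∀ i C, ¬ I.NSDeviation P i C

/-- Individual stability. -/
def IndividuallyStable (P : I.Outcome) : Prop := ∀ i C, ¬ I.ISDeviation P i C

/-- The outcome respects the three bounds given with the instance. A coalition is trivial if it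
has exactly one member. -/
def Admissible (P : I.Outcome) : Prop :=
  P.parts.card ≤ I.maxCoalitions ∧
  (P.parts.filter fun C => C.card ≠ 1).card ≤ I.maxNontrivial ∧
  ∀ C ∈ P.parts, C.card ≤ I.maxSize

/-- Yes-instances of HDG-Nash. -/
def NashYes : Prop := ∃ P : I.Outcome, I.Admissible P ∧ I.NashStable P

/-- Yes-instances of HDG-Individual. -/
def IndividualYes : Prop := ∃ P : I.Outcome, I.Admissible P ∧ I.IndividuallyStable P

/-! ### Input format: explicit part and preference oracle -/

/-- The number `k` in unary. Hardness for unary numbers is at least as strong as for binary. -/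
def encodeUnary (k : ℕ) : List Bool := List.replicate k true ++ [false]

/-- The explicit part of the input: everything but the preferences. -/
def encode : List Bool :=
  encodeUnary I.n ++ encodeUnary I.γ ++ encodeUnary I.maxSize ++ encodeUnary I.maxCoalitions ++
    encodeUnary I.maxNontrivial ++ (List.ofFn fun i => encodeUnary (I.color i)).flatten

/-- A query to the preference oracle: an agent and two coalitions to be compared. -/
abbrev Query : Type := Fin I.n × I.Coalition × I.Coalition

open Classical in
/-- The answer of the preference oracle: does the agent weakly prefer the first coalition? -/
noncomputable def oracle (q : I.Query) : Bool := decide (I.WeakPref q.1 q.2.1 q.2.2)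

/-- A set of agents as its characteristic word of length `n`. -/
def encodeSet (C : Finset (Fin I.n)) : List Bool := List.ofFn fun i => decide (i ∈ C)

/-- Encoding of a query: the agent's number in unary and the two characteristic words. -/
def encodeQuery (q : I.Query) : List (Option Bool) :=
  (encodeUnary q.1).map some ++ none :: (I.encodeSet q.2.1.1).map some ++
    none :: (I.encodeSet q.2.2.1).map some

end HDGInstance

/-- The family `F` of instances, indexed by binary words `x`, is constructible in polynomial time
in the oracle model: the explicit part of `F x` can be computed from `x` in polynomial time, and
the preference oracle of `F x` can be implemented in polynomial time, i.e. its answer to a query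
can be computed in time polynomial in the lengths of `x` and the query. -/
def PolyTimeConstructible (F : List Bool → HDGInstance) : Prop :=
  Nonempty (Turing.TM2ComputableInPolyTime (id : List Bool → List Bool) HDGInstance.encode F) ∧
  Nonempty (Turing.TM2ComputableInPolyTime
    (fun a : (Σ x : List Bool, (F x).Query) => a.1.map some ++ none :: (F a.1).encodeQuery a.2)
    (fun b : Bool => [b])
    (fun a => (F a.1).oracle a.2))

/-- The problem of deciding `Yes` is NP-hard (in the oracle model, under polynomial-time many-one
reductions) even when restricted to the instances that satisfy `R`. -/
def NPHardRestricted (Yes R : HDGInstance → Prop) : Prop :=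
  ∀ L : Set (List Bool), InNP L →
    ∃ F : List Bool → HDGInstance, PolyTimeConstructible F ∧ (∀ x, R (F x)) ∧
      ∀ x, x ∈ L ↔ Yes (F x)

/-!
From a word and a bound on the length of certificates, build a game whose agents are a guard, two
leaders, and one agent for each bit of a certificate. All colors are different, so that palettes
determine coalitions. The guard wants to be alone, which leaves two coalitions for the other agents,
and the leaders want to be apart. Hence every bit agent sits with the left or with the right leader,
and the outcome spells a word. The right leader refuses to have all the bits; so the left leader
has some, and it only tolerates those that spell an accepted certificate: the verifier is run inside
the preference oracle. Each of these three agents could obtain what it wants by being alone, so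
individual rationality already forces an accepted certificate. Conversely, in the outcome that
spells an accepted certificate these three are content and the bit agents are indifferent, so it is
Nash stable. Preferences are dichotomous. Two types of agents suffice because an agent is asked only
about coalitions that contain it, which allows agents with different roles to share a type.
-/

section

open Finset

/-! ### Individual rationality -/

namespace HDGInstance

/-- Individual rationality: no agent strictly prefers leaving its coalition to be alone. It is
implied by either notion of stability. -/
def IndividuallyRational (I : HDGInstance) (P : I.Outcome) : Prop :=
  ∀ i, ¬ I.StrictPref i (I.join i ∅) (I.coalitionOf P i)

/-- Yes-instances of the problem that asks for an admissible individually rational outcome. -/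
def RationalYes (I : HDGInstance) : Prop :=
  ∃ P : I.Outcome, I.Admissible P ∧ I.IndividuallyRational P

variable {I : HDGInstance} {P : I.Outcome}

theorem NashStable.individuallyStable (hP : I.NashStable P) : I.IndividuallyStable P :=
  fun i C hC => hP i C hC.1

theorem IndividuallyStable.individuallyRational (hP : I.IndividuallyStable P) :
    I.IndividuallyRational P :=
  fun i hi => hP i ∅ ⟨⟨.inr rfl, hi⟩, fun j hj => absurd hj (notMem_empty j)⟩

theorem NashYes.individualYes : I.NashYes → I.IndividualYes
  | ⟨P, hadm, hP⟩ => ⟨P, hadm, hP.individuallyStable⟩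

theorem IndividualYes.rationalYes : I.IndividualYes → I.RationalYes
  | ⟨P, hadm, hP⟩ => ⟨P, hadm, hP.individuallyRational⟩

end HDGInstance

/-! ### Games in which all colors are different -/

/-- The colors that occur in the coalitions with a given palette. -/
def colorSupport {n γ : ℕ} {color : Fin n → Fin γ} (p : PaletteOf color) : Finset (Fin γ) :=
  univ.filter fun c => p.1 c ≠ 0

theorem colorSupport_palette {n γ : ℕ} (color : Fin n → Fin γ) {C : Finset (Fin n)}
    (hC : C.Nonempty) :
    colorSupport (⟨palette color C, C, hC, rfl⟩ : PaletteOf color) = C.image color := by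
  have hcard : (C.card : ℚ) ≠ 0 := Nat.cast_ne_zero.2 (card_ne_zero.2 hC)
  ext c
  simp [colorSupport, palette, hcard, filter_eq_empty_iff]

theorem ncard_range_eq_of_ker_eq {ι α β : Type*} {f : ι → α} {g : ι → β}
    (h : Setoid.ker f = Setoid.ker g) : (Set.range f).ncard = (Set.range g).ncard := by
  rw [← Nat.card_coe_set_eq, ← Nat.card_coe_set_eq,
    ← Nat.card_congr (Setoid.quotientKerEquivRange f),
    ← Nat.card_congr (Setoid.quotientKerEquivRange g), h]

/-- The weak order in which a coalition is the better the larger its utility `v`, when all colors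
are different and a palette thus amounts to a coalition. -/
def utilityOrder {β : Type*} [LinearOrder β] {n : ℕ} (v : Finset (Fin n) → β) :
    WeakOrder (PaletteOf (id : Fin n → Fin n)) where
  rel p q := v (colorSupport q) ≤ v (colorSupport p)
  total p q := le_total (v (colorSupport q)) (v (colorSupport p))
  trans _ _ _ hpq hqr := hqr.trans hpq

theorem utilityOrder_rel_iff {β : Type*} [LinearOrder β] {n : ℕ} (v : Finset (Fin n) → β)
    {C D : Finset (Fin n)} (hC : C.Nonempty) (hD : D.Nonempty) :
    (utilityOrder v).rel ⟨palette id C, C, hC, rfl⟩ ⟨palette id D, D, hD, rfl⟩ ↔ v D ≤ v C :=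
  iff_of_eq <| congrArg₂ (v · ≤ v ·) ((colorSupport_palette id hD).trans image_id)
    ((colorSupport_palette id hC).trans image_id)

theorem utilityOrder_eq_iff {β : Type*} [LinearOrder β] {n : ℕ} {v w : Finset (Fin n) → β} :
    utilityOrder v = utilityOrder w ↔ ∀ C D : Finset (Fin n), C.Nonempty → D.Nonempty →
      (v D ≤ v C ↔ w D ≤ w C) := by
  constructor
  · intro h C D hC hD
    rw [← utilityOrder_rel_iff v hC hD, h, utilityOrder_rel_iff w hC hD]
  · intro h
    ext ⟨_, C, hC, rfl⟩ ⟨_, D, hD, rfl⟩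
    exact (utilityOrder_rel_iff v hC hD).trans
      ((h C D hC hD).trans (utilityOrder_rel_iff w hC hD).symm)

/-- The game in which all agents have different colors and an agent of type `t` values its
coalition by the utility function `u t`. The orders of all types belong to the set of weak orders,
whether or not some agent has them. -/
def rainbowGame {ι β : Type*} [LinearOrder β] (n : ℕ) (type : Fin n → ι)
    (u : ι → Finset (Fin n) → β) (maxCoalitions maxNontrivial : ℕ) : HDGInstance where
  n := n
  γ := n
  color := id
  color_surjective := Function.surjective_id
  M := Set.range fun t => utilityOrder (u t)
  pref i := utilityOrder (u (type i))
  pref_mem i := ⟨type i, rfl⟩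
  maxSize := n
  maxCoalitions := maxCoalitions
  maxNontrivial := maxNontrivial

namespace rainbowGame

variable {ι β : Type*} [LinearOrder β] {n : ℕ} {type : Fin n → ι} {u : ι → Finset (Fin n) → β}
  {k l : ℕ}

theorem weakPref_iff (i : Fin n) (C D : (rainbowGame n type u k l).Coalition) :
    (rainbowGame n type u k l).WeakPref i C D ↔ u (type i) D.1 ≤ u (type i) C.1 :=
  utilityOrder_rel_iff (u (type i)) C.2 D.2

theorem strictPref_iff (i : Fin n) (C D : (rainbowGame n type u k l).Coalition) :
    (rainbowGame n type u k l).StrictPref i C D ↔ u (type i) D.1 < u (type i) C.1 :=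
  ((weakPref_iff i C D).and (weakPref_iff i D C).not).trans lt_iff_le_not_ge.symm

theorem numTypes_eq_ncard_range {κ : Type*} {v : ι → κ}
    (h : ∀ s t, (∀ C D : Finset (Fin n), C.Nonempty → D.Nonempty →
      (u s D ≤ u s C ↔ u t D ≤ u t C)) ↔ v s = v t) :
    (rainbowGame n type u k l).numTypes = (Set.range v).ncard :=
  ncard_range_eq_of_ker_eq (Setoid.ext fun s t => utilityOrder_eq_iff.trans (h s t))

end rainbowGame

/-! ### Partitions into fibers -/

/-- The partition of a finite type into the nonempty fibers of a function. -/
def fiberPartition {α β : Type*} [Fintype α] [DecidableEq α] [DecidableEq β] (f : α → β) :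
    Finpartition (univ : Finset α) :=
  haveI : DecidableRel (Setoid.ker f).r := fun a b => decEq (f a) (f b)
  Finpartition.ofSetoid (Setoid.ker f)

namespace fiberPartition

variable {α β : Type*} [Fintype α] [DecidableEq α] [DecidableEq β] (f : α → β)

theorem part_eq (a : α) : (fiberPartition f).part a = univ.filter (f · = f a) := by
  ext b
  rw [mem_filter_univ, fiberPartition, Finpartition.mem_part_ofSetoid_iff_rel, Setoid.ker_def,
    eq_comm]

theorem card_parts_le [Fintype β] : (fiberPartition f).parts.card ≤ Fintype.card β := by
  have hsub : (fiberPartition f).parts ⊆ univ.image fun c => univ.filter (f · = c) := by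
    intro C hC
    obtain ⟨a, ha⟩ := (fiberPartition f).nonempty_of_mem_parts hC
    rw [← (fiberPartition f).part_eq_of_mem hC ha, part_eq]
    exact mem_image_of_mem _ (mem_univ _)
  exact (card_le_card hsub).trans card_image_le

end fiberPartition

theorem card_nontrivial_parts_lt {α : Type*} [DecidableEq α] {s : Finset α} (P : Finpartition s)
    {a : α} (ha : {a} ∈ P.parts) :
    (P.parts.filter fun C => C.card ≠ 1).card < P.parts.card :=
  card_lt_card <| filter_ssubset.2 ⟨{a}, ha, by simp⟩

/-! ### The certificate game -/

/-- What the agents know about a coalition: whether the guard and the leaders belong to it, whether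
some and whether all bits belong to it, and whether its set of bits is accepted. -/
structure Profile where
  guard : Bool
  left : Bool
  right : Bool
  anyBit : Bool
  allBits : Bool
  accepted : Bool
  deriving DecidableEq, Fintype, Inhabited

/-- The agents with the roles `0`, `1`, `2` and `3` are the guard, the left leader, the right leader
and the bits. This is whether an agent with the given role belongs to the coalition. -/
def Profile.has (f : Profile) : Fin 4 → Bool := ![f.guard, f.left, f.right, f.anyBit]

/-- The profile of an agent alone that is not a bit. -/
def Profile.loner (c : Fin 3) (accepted : Bool) : Profile :=
  ⟨decide (c = 0), decide (c = 1), decide (c = 2), false, false, accepted⟩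

/-- The preferences of the certificate game are dichotomous. These are its types of agents, and the
type `leader` is a common type of the two leaders. -/
inductive AgentType
  | guard | left | right | leader | indifferent
  deriving DecidableEq

namespace AgentType

/-- The guard wants to be alone, the left leader accepts neither the right leader nor a nonempty set
of bits that is not accepted, and the right leader accepts neither the left leader nor all bits. -/
def approves : AgentType → Profile → Bool
  | guard, f => f.guard && !f.left && !f.right && !f.anyBit
  | left, f => f.left && !f.right && (!f.anyBit || f.accepted)
  | right, f => f.right && !f.left && !f.allBits
  | leader, f =>
    f.left && !f.right && (!f.anyBit || f.accepted) || f.right && !f.left && !f.allBits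
  | indifferent, _ => false

theorem eq_of_approves_le_iff_le {s t : AgentType} (b : Bool)
    (h : ∀ c d, s.approves (.loner c b) ≤ s.approves (.loner d b) ↔
      t.approves (.loner c b) ≤ t.approves (.loner d b)) : s = t := by
  revert b
  cases s <;> cases t <;> decide

/-- The type of the agents with a given role, if all roles have different types. -/
def ofRole : Fin 4 → AgentType := ![guard, left, right, indifferent]

/-- An assignment of `τ` types to the four roles, for `2 ≤ τ ≤ 4`. Since an agent belongs to the
coalitions it evaluates, merging the leaders does not change their preferences, nor does it change
those of the bits to give them the type of the guard. -/
def assign : ℕ → Fin 4 → AgentType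
  | 2 => ![guard, leader, leader, guard]
  | 3 => ![guard, leader, leader, indifferent]
  | _ => ofRole

theorem ncard_range_assign {τ : ℕ} (h₂ : 2 ≤ τ) (h₄ : τ ≤ 4) :
    (Set.range (assign τ)).ncard = τ := by
  rw [Set.ncard_eq_toFinset_card', Set.toFinset_range]
  interval_cases τ <;> decide

theorem approves_assign (τ : ℕ) {c : Fin 4} {f : Profile} (hf : f.has c = true) :
    (assign τ c).approves f = (ofRole c).approves f := by
  have guard_eq : ∀ f : Profile, f.anyBit = true → guard.approves f = false := by decide
  have left_eq : ∀ f : Profile, f.left = true → leader.approves f = left.approves f := by decide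
  have right_eq : ∀ f : Profile, f.right = true → leader.approves f = right.approves f := by
    decide
  unfold assign
  split
  · fin_cases c
    exacts [rfl, left_eq f hf, right_eq f hf, guard_eq f hf]
  · fin_cases c
    exacts [rfl, left_eq f hf, right_eq f hf, rfl]
  · rfl

end AgentType

variable {m : ℕ}

/-- The agent that represents the bit at a position of a certificate. -/
def bitAgent (j : Fin m) : Fin (m + 3) := j.succ.succ.succ

/-- The bits of a coalition, as a word. -/
def bitsOf (X : Finset (Fin (m + 3))) : List Bool := List.ofFn fun j => decide (bitAgent j ∈ X)

/-- The profile of a coalition with characteristic word `a :: b :: c :: r`. -/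
def Profile.ofWord (acc : List Bool → Bool) (a b c : Bool) (r : List Bool) : Profile :=
  ⟨a, b, c, r.any id, r.all id, acc r⟩

/-- The profile of a coalition. -/
def Profile.ofCoalition (acc : List Bool → Bool) (X : Finset (Fin (m + 3))) : Profile :=
  .ofWord acc (decide (0 ∈ X)) (decide (1 ∈ X)) (decide (2 ∈ X)) (bitsOf X)

/-- The role of the agent with number `n`. -/
def roleOf (n : ℕ) : Fin 4 := ⟨min n 3, by omega⟩

@[elab_as_elim]
theorem agent_cases {motive : Fin (m + 3) → Prop} (guard : motive 0) (left : motive 1)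
    (right : motive 2) (bit : ∀ j : Fin m, motive (bitAgent j)) (i : Fin (m + 3)) : motive i := by
  refine Fin.cases guard (Fin.cases left (Fin.cases right bit)) i

theorem roleOf_bitAgent (j : Fin m) : roleOf (bitAgent j) = 3 := by
  simp [roleOf, bitAgent]

theorem bitAgent_ne_guard (j : Fin m) : bitAgent j ≠ 0 := Fin.succ_ne_zero _

theorem bitAgent_ne_left (j : Fin m) : bitAgent j ≠ 1 := by
  simp [bitAgent, Fin.ext_iff]

theorem bitAgent_ne_right (j : Fin m) : bitAgent j ≠ 2 :=
  Fin.ne_of_val_ne (by simp [bitAgent, Nat.mod_eq_of_lt])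

theorem left_ne_right : (1 : Fin (m + 3)) ≠ 2 :=
  Fin.ne_of_val_ne (by simp [Nat.mod_eq_of_lt])

theorem right_ne_guard : (2 : Fin (m + 3)) ≠ 0 :=
  Fin.ne_of_val_ne (by simp [Nat.mod_eq_of_lt])

section Profile

variable (acc : List Bool → Bool) (X : Finset (Fin (m + 3)))

theorem any_bitsOf : (bitsOf X).any id = true ↔ ∃ j : Fin m, bitAgent j ∈ X := by
  simp [bitsOf, List.any_eq_true, List.mem_ofFn]

theorem all_bitsOf : (bitsOf X).all id = true ↔ ∀ j : Fin m, bitAgent j ∈ X := by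
  simp [bitsOf, List.all_eq_true, List.mem_ofFn]

variable {X} in
theorem Profile.has_roleOf {i : Fin (m + 3)} (hi : i ∈ X) :
    (Profile.ofCoalition acc X).has (roleOf i) = true := by
  induction i using agent_cases with
  | guard => exact decide_eq_true hi
  | left => exact decide_eq_true hi
  | right => exact decide_eq_true hi
  | bit j =>
    rw [roleOf_bitAgent]
    exact (any_bitsOf X).2 ⟨j, hi⟩

theorem exists_ofCoalition_eq_loner (hm : 0 < m) (c : Fin 3) :
    ∃ X : Finset (Fin (m + 3)), X.Nonempty ∧
      Profile.ofCoalition acc X = .loner c (acc (List.replicate m false)) := by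
  have key (i : Fin (m + 3)) (hi : ∀ j : Fin m, bitAgent j ≠ i) : Profile.ofCoalition acc {i} =
      ⟨decide (0 = i), decide (1 = i), decide (2 = i), false, false,
        acc (List.replicate m false)⟩ := by
    have hbits : bitsOf {i} = List.replicate m false := by
      simp [bitsOf, hi]
    simp [Profile.ofCoalition, Profile.ofWord, hbits, hm.ne']
  fin_cases c
  · exact ⟨{0}, singleton_nonempty 0, by
      simp [key 0 bitAgent_ne_guard, Profile.loner, right_ne_guard]⟩
  · exact ⟨{1}, singleton_nonempty 1, by
      simp [key 1 bitAgent_ne_left, Profile.loner, left_ne_right.symm]⟩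
  · exact ⟨{2}, singleton_nonempty 2, by
      simp [key 2 bitAgent_ne_right, Profile.loner, left_ne_right, right_ne_guard.symm]⟩

/-- Does the agent approve a coalition to which it belongs? -/
def agentApproves (i : Fin (m + 3)) : Bool :=
  (AgentType.ofRole (roleOf i)).approves (.ofCoalition acc X)

theorem agentApproves_guard_iff : agentApproves acc X 0 = true ↔ X = {0} := by
  have key : agentApproves acc X 0 = true ↔
      0 ∈ X ∧ 1 ∉ X ∧ 2 ∉ X ∧ ∀ j : Fin m, bitAgent j ∉ X := by
    change AgentType.guard.approves (.ofCoalition acc X) = true ↔ _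
    simp [AgentType.approves, Profile.ofCoalition, Profile.ofWord, bitsOf, and_assoc]
  rw [key]
  constructor
  · rintro ⟨hguard, hleft, hright, hbits⟩
    ext i
    induction i using agent_cases <;> simp_all [bitAgent_ne_guard, right_ne_guard]
  · rintro rfl
    simp [bitAgent_ne_guard, right_ne_guard]

theorem agentApproves_left_iff : agentApproves acc X 1 = true ↔
    1 ∈ X ∧ 2 ∉ X ∧ ((∃ j : Fin m, bitAgent j ∈ X) → acc (bitsOf X) = true) := by
  change AgentType.left.approves (.ofCoalition acc X) = true ↔ _
  rw [← any_bitsOf]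
  simp [AgentType.approves, Profile.ofCoalition, Profile.ofWord, and_assoc, imp_iff_not_or]

theorem agentApproves_right_iff : agentApproves acc X 2 = true ↔
    2 ∈ X ∧ 1 ∉ X ∧ ∃ j : Fin m, bitAgent j ∉ X := by
  change AgentType.right.approves (.ofCoalition acc X) = true ↔ _
  rw [← not_forall, ← all_bitsOf]
  simp [AgentType.approves, Profile.ofCoalition, Profile.ofWord, and_assoc]

theorem agentApproves_bitAgent (j : Fin m) : agentApproves acc X (bitAgent j) = false := by
  rw [agentApproves, roleOf_bitAgent]
  rfl

end Profile

theorem part_eq_or_eq_or_eq_of_card_parts_le_three {α : Type*} [DecidableEq α] {s : Finset α}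
    {P : Finpartition s} (hcard : P.parts.card ≤ 3) {a b c d : α} (ha : a ∈ s) (hb : b ∈ s)
    (hc : c ∈ s) (hd : d ∈ s) (hab : P.part a ≠ P.part b) (hac : P.part a ≠ P.part c)
    (hbc : P.part b ≠ P.part c) :
    P.part d = P.part a ∨ P.part d = P.part b ∨ P.part d = P.part c := by
  have hsub : {P.part a, P.part b, P.part c} ⊆ P.parts := by
    simp [insert_subset_iff, P.part_mem, ha, hb, hc]
  have heq : {P.part a, P.part b, P.part c} = P.parts :=
    eq_of_subset_of_card_le hsub (by rwa [card_eq_three.2 ⟨_, _, _, hab, hac, hbc, rfl⟩])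
  simpa [← heq] using P.part_mem.2 hd

theorem exists_accepted_of_agentApproves {acc : List Bool → Bool}
    {P : Finpartition (univ : Finset (Fin (m + 3)))} (hcard : P.parts.card ≤ 3)
    (hguard : agentApproves acc (P.part 0) 0 = true)
    (hleft : agentApproves acc (P.part 1) 1 = true)
    (hright : agentApproves acc (P.part 2) 2 = true) :
    ∃ r : List Bool, r.length = m ∧ r.any id = true ∧ acc r = true := by
  rw [agentApproves_guard_iff] at hguard
  obtain ⟨left_mem, right_notMem, hacc⟩ := (agentApproves_left_iff acc _).1 hleft
  obtain ⟨right_mem, -, j, hj⟩ := (agentApproves_right_iff acc _).1 hright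
  have guard_ne_left : P.part 0 ≠ P.part 1 := by
    intro h
    rw [← h, hguard, mem_singleton] at left_mem
    simp at left_mem
  have guard_ne_right : P.part 0 ≠ P.part 2 := by
    intro h
    rw [← h, hguard, mem_singleton] at right_mem
    exact right_ne_guard right_mem
  have left_ne_right : P.part 1 ≠ P.part 2 := fun h => right_notMem (h ▸ right_mem)
  have hmem : bitAgent j ∈ P.part (bitAgent j) := P.mem_part (mem_univ _)
  have hj_left : bitAgent j ∈ P.part 1 := by
    rcases part_eq_or_eq_or_eq_of_card_parts_le_three hcard (mem_univ 0) (mem_univ 1) (mem_univ 2)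
      (mem_univ (bitAgent j)) guard_ne_left guard_ne_right left_ne_right with h | h | h
    · rw [h, hguard, mem_singleton] at hmem
      exact absurd hmem (bitAgent_ne_guard j)
    · rwa [h] at hmem
    · exact absurd (h ▸ hmem) hj
  exact ⟨bitsOf (P.part 1), List.length_ofFn, (any_bitsOf _).2 ⟨j, hj_left⟩, hacc ⟨j, hj_left⟩⟩

/-- The coalition of an agent in the outcome given by a word: the guard is alone, the bits that are
set are with the left leader, the other ones with the right leader. -/
def side (r : Fin m → Bool) : Fin (m + 3) → Fin 3 :=
  Fin.cons 0 (Fin.cons 1 (Fin.cons 2 fun j => if r j then 1 else 2))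

/-- The outcome given by a word. -/
def wordOutcome (r : Fin m → Bool) : Finpartition (univ : Finset (Fin (m + 3))) :=
  fiberPartition (side r)

section WordOutcome

variable (r : Fin m → Bool)

theorem side_guard : side r 0 = 0 := rfl

theorem side_left : side r 1 = 1 := rfl

theorem side_right : side r 2 = 2 := rfl

theorem side_bitAgent (j : Fin m) : side r (bitAgent j) = if r j then 1 else 2 := rfl

theorem mem_part_wordOutcome (i j : Fin (m + 3)) :
    j ∈ (wordOutcome r).part i ↔ side r j = side r i := by
  rw [wordOutcome, fiberPartition.part_eq, mem_filter_univ]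

theorem part_guard_wordOutcome : (wordOutcome r).part 0 = {0} := by
  ext i
  rw [mem_part_wordOutcome, mem_singleton, side_guard]
  induction i using agent_cases with
  | guard => simp [side_guard]
  | left => simp [side_left]
  | right => simp [side_right, right_ne_guard]
  | bit j => cases h : r j <;> simp [side_bitAgent, bitAgent_ne_guard, h]

theorem bitAgent_mem_part_left_iff (j : Fin m) :
    bitAgent j ∈ (wordOutcome r).part 1 ↔ r j = true := by
  rw [mem_part_wordOutcome, side_bitAgent, side_left]
  cases r j <;> simp

theorem bitsOf_part_left : bitsOf ((wordOutcome r).part 1) = List.ofFn r := by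
  simp [bitsOf, bitAgent_mem_part_left_iff]

theorem agentApproves_wordOutcome {acc : List Bool → Bool}
    (hr : ∃ j, r j = true) (hacc : acc (List.ofFn r) = true) :
    agentApproves acc ((wordOutcome r).part 0) 0 = true ∧
      agentApproves acc ((wordOutcome r).part 1) 1 = true ∧
      agentApproves acc ((wordOutcome r).part 2) 2 = true := by
  obtain ⟨j, hj⟩ := hr
  refine ⟨(agentApproves_guard_iff acc _).2 (part_guard_wordOutcome r),
    (agentApproves_left_iff acc _).2 ⟨?_, ?_, fun _ => ?_⟩,
    (agentApproves_right_iff acc _).2 ⟨?_, ?_, j, ?_⟩⟩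
  · exact (mem_part_wordOutcome r 1 1).2 rfl
  · simp [mem_part_wordOutcome, side_left, side_right]
  · rwa [bitsOf_part_left]
  · exact (mem_part_wordOutcome r 2 2).2 rfl
  · simp [mem_part_wordOutcome, side_left, side_right]
  · simp [mem_part_wordOutcome, side_bitAgent, side_right, hj]

theorem card_parts_wordOutcome : (wordOutcome r).parts.card ≤ 3 :=
  fiberPartition.card_parts_le (side r)

theorem card_nontrivial_parts_wordOutcome :
    ((wordOutcome r).parts.filter fun C => C.card ≠ 1).card ≤ 2 := by
  have hguard : {0} ∈ (wordOutcome r).parts := by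
    rw [← part_guard_wordOutcome r]
    exact (wordOutcome r).part_mem.2 (mem_univ _)
  exact Nat.le_of_lt_succ <|
    (card_nontrivial_parts_lt _ hguard).trans_le (card_parts_wordOutcome r)

end WordOutcome

/-- The game on a guard, two leaders and `m` bits in which the left leader accepts those sets of
bits that `acc` accepts. -/
def certificateGame (τ m : ℕ) (acc : List Bool → Bool) (ρ : ℕ) : HDGInstance :=
  rainbowGame (m + 3) (fun i => roleOf i)
    (fun c X => (AgentType.assign τ c).approves (.ofCoalition acc X)) 3 ρ

namespace certificateGame

variable {τ ρ : ℕ} {acc : List Bool → Bool}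

theorem strictPref_iff {i : Fin (m + 3)} {C D : (certificateGame τ m acc ρ).Coalition}
    (hC : i ∈ C.1) (hD : i ∈ D.1) : (certificateGame τ m acc ρ).StrictPref i C D ↔
      agentApproves acc C.1 i = true ∧ agentApproves acc D.1 i = false := by
  refine (rainbowGame.strictPref_iff i C D).trans ?_
  rw [AgentType.approves_assign τ (Profile.has_roleOf acc hC),
    AgentType.approves_assign τ (Profile.has_roleOf acc hD), Bool.lt_iff]
  exact and_comm

theorem numTypes_eq (hm : 0 < m) (h₂ : 2 ≤ τ) (h₄ : τ ≤ 4) :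
    (certificateGame τ m acc ρ).numTypes = τ := by
  refine Eq.trans (rainbowGame.numTypes_eq_ncard_range fun s t => ⟨fun h => ?_, fun h => ?_⟩)
    (AgentType.ncard_range_assign h₂ h₄)
  · refine AgentType.eq_of_approves_le_iff_le (acc (List.replicate m false)) fun c d => ?_
    obtain ⟨X, hX, hXc⟩ := exists_ofCoalition_eq_loner acc hm c
    obtain ⟨Y, hY, hYd⟩ := exists_ofCoalition_eq_loner acc hm d
    simpa only [hXc, hYd] using h Y X hY hX
  · intro C D _ _
    rw [h]

theorem nashStable_of_agentApproves {P : Finpartition (univ : Finset (Fin (m + 3)))}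
    (hguard : agentApproves acc (P.part 0) 0 = true)
    (hleft : agentApproves acc (P.part 1) 1 = true)
    (hright : agentApproves acc (P.part 2) 2 = true) :
    (certificateGame τ m acc ρ).NashStable P := by
  rintro i C ⟨-, hstrict⟩
  obtain ⟨hjoin, hpart⟩ :=
    (strictPref_iff (mem_insert_self i C) (P.mem_part (mem_univ i))).1 hstrict
  induction i using agent_cases with
  | guard => exact Bool.false_ne_true (hpart.symm.trans hguard)
  | left => exact Bool.false_ne_true (hpart.symm.trans hleft)
  | right => exact Bool.false_ne_true (hpart.symm.trans hright)
  | bit j => exact Bool.false_ne_true ((agentApproves_bitAgent acc _ j).symm.trans hjoin)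

theorem agentApproves_part_of_individuallyRational {P : Finpartition (univ : Finset (Fin (m + 3)))}
    (hP : (certificateGame τ m acc ρ).IndividuallyRational P) {i : Fin (m + 3)}
    (hi : agentApproves acc {i} i = true) : agentApproves acc (P.part i) i = true := by
  by_contra hpart
  exact hP i <| (strictPref_iff (mem_insert_self i ∅) (P.mem_part (mem_univ i))).2
    ⟨hi, Bool.eq_false_iff.2 hpart⟩

theorem nashYes (hρ : 2 ≤ ρ) {r : List Bool} (hr : r.any id = true) (hacc : acc r = true) :
    (certificateGame τ r.length acc ρ).NashYes := by
  have hset : ∃ j, r.get j = true := by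
    obtain ⟨b, hb, htrue⟩ := List.any_eq_true.1 hr
    obtain ⟨j, rfl⟩ := List.get_of_mem hb
    exact ⟨j, htrue⟩
  obtain ⟨hguard, hleft, hright⟩ := agentApproves_wordOutcome (acc := acc) r.get hset
    (by rwa [List.ofFn_get])
  exact ⟨wordOutcome r.get, ⟨card_parts_wordOutcome _,
    (card_nontrivial_parts_wordOutcome _).trans hρ, fun C _ => card_finset_fin_le C⟩,
    nashStable_of_agentApproves hguard hleft hright⟩

theorem exists_accepted_of_rationalYes (hm : 0 < m)
    (h : (certificateGame τ m acc ρ).RationalYes) :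
    ∃ r : List Bool, r.length = m ∧ r.any id = true ∧ acc r = true := by
  obtain ⟨P, ⟨hcard, -⟩, hP⟩ := h
  refine exists_accepted_of_agentApproves (P := P) hcard
    (agentApproves_part_of_individuallyRational hP ?_)
    (agentApproves_part_of_individuallyRational hP ?_)
    (agentApproves_part_of_individuallyRational hP ?_)
  · exact (agentApproves_guard_iff acc _).2 rfl
  · refine (agentApproves_left_iff acc _).2 ⟨mem_singleton_self 1, ?_, ?_⟩
    · rw [mem_singleton]
      exact left_ne_right.symm
    · rintro ⟨j, hj⟩
      exact absurd (mem_singleton.1 hj) (bitAgent_ne_left j)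
  · refine (agentApproves_right_iff acc _).2 ⟨mem_singleton_self 2, ?_, ⟨0, hm⟩, ?_⟩
    · rw [mem_singleton]
      exact left_ne_right
    · rw [mem_singleton]
      exact bitAgent_ne_right _

end certificateGame

end

/-! ### Programs of stack machines -/

/-- Iterating the partial function `f` leads from `a` to `b` in at most `T` steps. -/
def ReachesIn {α : Type} (f : α → Option α) (a b : α) (T : ℕ) : Prop :=
  Nonempty (StateTransition.EvalsToInTime f a (some b) T)

namespace ReachesIn

variable {α β : Type} {f : α → Option α} {f' : β → Option β} {a b c : α} {T T₁ T₂ : ℕ}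

theorem mono (h : ReachesIn f a b T₁) (hT : T₁ ≤ T₂) : ReachesIn f a b T₂ :=
  h.map fun e => ⟨e.toEvalsTo, e.steps_le_m.trans hT⟩

theorem trans (h₁ : ReachesIn f a b T₁) (h₂ : ReachesIn f b c T₂) : ReachesIn f a c (T₁ + T₂) := by
  obtain ⟨e₁⟩ := h₁
  obtain ⟨e₂⟩ := h₂
  exact ⟨add_comm T₂ T₁ ▸ e₁.trans f T₁ T₂ a b (some c) e₂⟩

theorem single (h : f a = some b) : ReachesIn f a b 1 :=
  ⟨⟨⟨1, h⟩, le_rfl⟩⟩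

theorem map (g : α → β) (hg : ∀ a b, f a = some b → f' (g a) = some (g b))
    (h : ReachesIn f a b T) : ReachesIn f' (g a) (g b) T := by
  obtain ⟨⟨⟨t, ht⟩, htT⟩⟩ := h
  refine ⟨⟨⟨t, ?_⟩, htT⟩⟩
  clear htT
  induction t generalizing b with
  | zero => exact congrArg (some ∘ g) (Option.some.inj ht)
  | succ t ih =>
    rw [Function.iterate_succ_apply'] at ht ⊢
    obtain ⟨b₁, hb₁, hb⟩ := Option.bind_eq_some_iff.1 ht
    rw [ih hb₁]
    exact hg b₁ b hb

end ReachesIn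

open Turing Turing.TM2 Turing.TM2.Stmt

/-- A program for a machine with stacks over the alphabets `Γ` and a register with values in `σ`.
It is a fragment of a machine: halting passes control to whatever comes next. -/
structure StackProgram {K : Type} (Γ : K → Type) (σ : Type) where
  Λ : Type
  [fintype : Fintype Λ]
  main : Λ
  m : Λ → Stmt Γ Λ σ

attribute [instance] StackProgram.fintype

namespace StackProgram

variable {K : Type} {Γ : K → Type} {σ : Type}

section Combinators

variable [DecidableEq K] {v v₁ v₂ v' : σ} {S S₁ S₂ S' : ∀ k, List (Γ k)} {T T₁ T₂ : ℕ}

/-- Started with `v` in the register and stacks `S`, the program `p` halts with `v'` in the register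
and stacks `S'` after at most `T` steps. -/
def Runs (p : StackProgram Γ σ) (v : σ) (S : ∀ k, List (Γ k)) (v' : σ) (S' : ∀ k, List (Γ k))
    (T : ℕ) : Prop :=
  ReachesIn (TM2.step p.m) ⟨some p.main, v, S⟩ ⟨none, v', S'⟩ T

theorem Runs.mono {p : StackProgram Γ σ} (h : Runs p v S v' S' T₁) (hT : T₁ ≤ T₂) :
    Runs p v S v' S' T₂ :=
  ReachesIn.mono h hT

theorem Runs.of_eq_of_le {p : StackProgram Γ σ} (h : Runs p v S v' S₁ T₁) (hS : S₁ = S')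
    (hT : T₁ ≤ T₂) : Runs p v S v' S' T₂ :=
  hS ▸ h.mono hT

section ExitTo

variable {Λ Λ' : Type}

/-- Rename the labels of a statement by `f` and replace `halt` by `e`. -/
def exitTo (f : Λ → Λ') (e : Stmt Γ Λ' σ) : Stmt Γ Λ σ → Stmt Γ Λ' σ
  | push k g q => push k g (exitTo f e q)
  | peek k g q => peek k g (exitTo f e q)
  | pop k g q => pop k g (exitTo f e q)
  | load g q => load g (exitTo f e q)
  | branch g q₁ q₂ => branch g (exitTo f e q₁) (exitTo f e q₂)
  | goto g => goto fun v => f (g v)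
  | halt => e

/-- The configuration of a machine that continues with `e` where the given one has halted. -/
def exitCfg (f : Λ → Λ') (e : Stmt Γ Λ' σ) : Cfg Γ Λ σ → Cfg Γ Λ' σ
  | ⟨some l, v, S⟩ => ⟨some (f l), v, S⟩
  | ⟨none, v, S⟩ => stepAux e v S

theorem stepAux_exitTo (f : Λ → Λ') (e : Stmt Γ Λ' σ) (q : Stmt Γ Λ σ) (v : σ)
    (S : ∀ k, List (Γ k)) : stepAux (exitTo f e q) v S = exitCfg f e (stepAux q v S) := by
  induction q generalizing v S with
  | push _ _ _ ih | peek _ _ _ ih | pop _ _ _ ih | load _ _ ih => exact ih _ _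
  | branch g q₁ q₂ ih₁ ih₂ =>
    simp only [exitTo, stepAux]
    cases g v
    · exact ih₂ _ _
    · exact ih₁ _ _
  | goto g => rfl
  | halt => rfl

theorem Runs.exitTo {p : StackProgram Γ σ} {M' : Λ' → Stmt Γ Λ' σ} {f : p.Λ → Λ'}
    {e : Stmt Γ Λ' σ} (h : Runs p v S v' S' T) (hM : ∀ l, M' (f l) = exitTo f e (p.m l)) :
    ReachesIn (TM2.step M') ⟨some (f p.main), v, S⟩ (stepAux e v' S') T := by
  refine ReachesIn.map (exitCfg f e) ?_ h
  rintro ⟨_ | l, w, R⟩ d hd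
  · cases hd
  · cases hd
    exact congrArg some ((congrArg (stepAux · w R) (hM l)).trans (stepAux_exitTo f e (p.m l) w R))

end ExitTo

theorem reachesIn_of_stepAux {Λ : Type} (M : Λ → Stmt Γ Λ σ) {l : Λ} {c : Cfg Γ Λ σ}
    (h : stepAux (M l) v S = c) : ReachesIn (TM2.step M) ⟨some l, v, S⟩ c 1 :=
  .single (congrArg some h)

/-- A single statement, repeated as long as it ends with `goto`. -/
def ofStmt (s : Stmt Γ Unit σ) : StackProgram Γ σ := ⟨Unit, (), fun _ => s⟩

theorem Runs.ofStmt_halt {s : Stmt Γ Unit σ} (h : stepAux s v S = ⟨none, v', S'⟩) :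
    Runs (ofStmt s) v S v' S' 1 :=
  reachesIn_of_stepAux (ofStmt s).m h

theorem Runs.ofStmt_goto {s : Stmt Γ Unit σ} (h : stepAux s v S = ⟨some (), v₁, S₁⟩)
    (h' : Runs (ofStmt s) v₁ S₁ v' S' T) : Runs (ofStmt s) v S v' S' (T + 1) :=
  ((reachesIn_of_stepAux (ofStmt s).m h).trans h').mono (Nat.add_comm 1 T).le

/-- First `p`, then `q`. -/
def seq (p q : StackProgram Γ σ) : StackProgram Γ σ where
  Λ := p.Λ ⊕ q.Λ
  main := .inl p.main
  m := Sum.elim (fun l => exitTo .inl (goto fun _ => .inr q.main) (p.m l))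
    (fun l => exitTo .inr halt (q.m l))

theorem Runs.seq {p q : StackProgram Γ σ} (hp : Runs p v S v₁ S₁ T₁) (hq : Runs q v₁ S₁ v' S' T₂) :
    Runs (seq p q) v S v' S' (T₁ + T₂) :=
  (hp.exitTo (M' := (p.seq q).m) (f := .inl) fun _ => rfl).trans
    (hq.exitTo (M' := (p.seq q).m) (f := .inr) fun _ => rfl)

/-- Execute `s`; if it ends with `goto`, execute `p` and start again. -/
def loop (s : Stmt Γ Unit σ) (p : StackProgram Γ σ) : StackProgram Γ σ where
  Λ := Option p.Λ
  main := none
  m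
    | none => exitTo (fun _ => some p.main) halt s
    | some l => exitTo some (goto fun _ => none) (p.m l)

theorem Runs.loop_halt {s : Stmt Γ Unit σ} {p : StackProgram Γ σ}
    (h : stepAux s v S = ⟨none, v', S'⟩) : Runs (loop s p) v S v' S' 1 :=
  reachesIn_of_stepAux (loop s p).m (l := none)
    ((stepAux_exitTo _ _ s v S).trans (congrArg _ h))

theorem Runs.loop_goto {s : Stmt Γ Unit σ} {p : StackProgram Γ σ}
    (h : stepAux s v S = ⟨some (), v₁, S₁⟩) (hp : Runs p v₁ S₁ v₂ S₂ T₁)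
    (h' : Runs (loop s p) v₂ S₂ v' S' T₂) : Runs (loop s p) v S v' S' (1 + T₁ + T₂) :=
  ((reachesIn_of_stepAux (loop s p).m (l := none)
    ((stepAux_exitTo _ _ s v S).trans (congrArg _ h))).trans
    (hp.exitTo (M' := (loop s p).m) (f := some) fun _ => rfl)).trans h'

end Combinators

/-! ### Machines with additional stacks and registers -/

section Lift

variable {K₀ : Type} {Γ₀ : K₀ → Type}

/-- The alphabets of two kinds of stacks, put together. -/
abbrev SumAlphabet (Γ : K → Type) (Γ₀ : K₀ → Type) : K ⊕ K₀ → Type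
  | .inl k => Γ k
  | .inr k => Γ₀ k

/-- Stacks of two kinds, put together. -/
def join (S : ∀ k, List (Γ k)) (S₀ : ∀ k, List (Γ₀ k)) : ∀ k, List (SumAlphabet Γ Γ₀ k)
  | .inl k => S k
  | .inr k => S₀ k

variable [DecidableEq K] [DecidableEq K₀]

theorem update_join_inl (S : ∀ k, List (Γ k)) (S₀ : ∀ k, List (Γ₀ k)) (k : K) (l : List (Γ k)) :
    Function.update (join S S₀) (.inl k) l = join (Function.update S k l) S₀ := by
  rw [Function.update_eq_iff]
  refine ⟨(Function.update_self k l S).symm, ?_⟩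
  rintro (j | j) hj
  · exact (Function.update_of_ne (fun h => hj (congrArg _ h)) l S).symm
  · rfl

theorem update_join_inr (S : ∀ k, List (Γ k)) (S₀ : ∀ k, List (Γ₀ k)) (k : K₀)
    (l : List (Γ₀ k)) :
    Function.update (join S S₀) (.inr k) l = join S (Function.update S₀ k l) := by
  rw [Function.update_eq_iff]
  refine ⟨(Function.update_self k l S₀).symm, ?_⟩
  rintro (j | j) hj
  · rfl
  · exact (Function.update_of_ne (fun h => hj (congrArg _ h)) l S₀).symm

/-- The same statement on a machine with additional stacks and an additional register. -/
def liftStmt {Λ : Type} (Γ₀ : K₀ → Type) (ρ : Type) :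
    Stmt Γ Λ σ → Stmt (SumAlphabet Γ Γ₀) Λ (σ × ρ)
  | push k g q => push (.inl k) (fun v => g v.1) (liftStmt Γ₀ ρ q)
  | peek k g q => peek (.inl k) (fun v a => (g v.1 a, v.2)) (liftStmt Γ₀ ρ q)
  | pop k g q => pop (.inl k) (fun v a => (g v.1 a, v.2)) (liftStmt Γ₀ ρ q)
  | load g q => load (fun v => (g v.1, v.2)) (liftStmt Γ₀ ρ q)
  | branch g q₁ q₂ => branch (fun v => g v.1) (liftStmt Γ₀ ρ q₁) (liftStmt Γ₀ ρ q₂)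
  | goto g => goto fun v => g v.1
  | halt => halt

theorem stepAux_liftStmt {Λ ρ : Type} (q : Stmt Γ Λ σ) (v : σ) (r : ρ) (S : ∀ k, List (Γ k))
    (S₀ : ∀ k, List (Γ₀ k)) :
    stepAux (liftStmt Γ₀ ρ q) (v, r) (join S S₀) =
      ⟨(stepAux q v S).l, ((stepAux q v S).var, r), join (stepAux q v S).stk S₀⟩ := by
  induction q generalizing v S with
  | push k _ _ ih | pop k _ _ ih =>
    exact (congrArg _ (update_join_inl S S₀ k _)).trans (ih _ _)
  | peek _ _ _ ih | load _ _ ih => exact ih _ _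
  | branch g q₁ q₂ ih₁ ih₂ =>
    simp only [liftStmt, stepAux]
    cases g v
    · exact ih₂ _ _
    · exact ih₁ _ _
  | goto g => rfl
  | halt => rfl

/-- The same program on a machine with additional stacks and an additional register. -/
def lift (Γ₀ : K₀ → Type) (ρ : Type) (p : StackProgram Γ σ) :
    StackProgram (SumAlphabet Γ Γ₀) (σ × ρ) :=
  ⟨p.Λ, p.main, fun l => liftStmt Γ₀ ρ (p.m l)⟩

theorem Runs.lift {ρ : Type} {p : StackProgram Γ σ} {v v' : σ} {S S' : ∀ k, List (Γ k)} {T : ℕ}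
    (h : Runs p v S v' S' T) (r : ρ) (S₀ : ∀ k, List (Γ₀ k)) :
    Runs (lift Γ₀ ρ p) (v, r) (join S S₀) (v', r) (join S' S₀) T := by
  refine ReachesIn.map (f' := TM2.step (StackProgram.lift Γ₀ ρ p).m)
    (fun c => ⟨c.l, (c.var, r), join c.stk S₀⟩) ?_ h
  rintro ⟨_ | l, w, R⟩ d hd
  · cases hd
  · cases hd
    exact congrArg some (stepAux_liftStmt (p.m l) w r R S₀)

end Lift

/-! ### Mathlib's bundled machines as programs -/

section Bundled

variable [DecidableEq K]

/-- All stacks but `k` are empty. -/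
def single (k : K) (l : List (Γ k)) : ∀ j, List (Γ j) := Function.update (fun _ => []) k l

theorem dite_eq_single (k : K) (l : List (Γ k)) :
    (fun j => @dite (List (Γ j)) (j = k) _ (fun h => by rw [h]; exact l) fun _ => []) =
      single k l := by
  funext j
  by_cases h : j = k
  · subst h
    simp [single]
  · simp [single, h]

/-- The program of a bundled machine. -/
def ofFinTM2 (tm : FinTM2) : StackProgram tm.Γ tm.σ where
  Λ := tm.Λ
  fintype := tm.ΛFin
  main := tm.main
  m := tm.m

/-- A program as a bundled machine, with input stack `k₀`, output stack `k₁` and `v₀` in the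
register at the beginning and at the end. -/
def toFinTM2 [Fintype K] [Fintype σ] (p : StackProgram Γ σ) (k₀ k₁ : K) [Fintype (Γ k₀)] (v₀ : σ) :
    FinTM2 where
  K := K
  k₀ := k₀
  k₁ := k₁
  Γ := Γ
  Λ := p.Λ
  main := p.main
  ΛFin := p.fintype
  σ := σ
  initialState := v₀
  m := p.m

theorem nonempty_outputsInTime_iff {tm : FinTM2} {l : List (tm.Γ tm.k₀)} {l' : List (tm.Γ tm.k₁)}
    {T : ℕ} : Nonempty (TM2OutputsInTime tm l (some l') T) ↔
      Runs (ofFinTM2 tm) tm.initialState (single tm.k₀ l) tm.initialState (single tm.k₁ l') T := by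
  rw [← dite_eq_single, ← dite_eq_single]
  rfl

theorem computableInPolyTime_of_runs [Finite K] [Finite σ] {α β αΓ βΓ : Type}
    {ea : α → List αΓ} {eb : β → List βΓ} {f : α → β} (p : StackProgram Γ σ) (k₀ k₁ : K)
    [Finite (Γ k₀)] (v₀ : σ) (e₀ : Γ k₀ ≃ αΓ) (e₁ : Γ k₁ ≃ βΓ) (time : Polynomial ℕ)
    (h : ∀ a, Runs p v₀ (single k₀ ((ea a).map e₀.symm)) v₀ (single k₁ ((eb (f a)).map e₁.symm))
      (time.eval (ea a).length)) :
    Nonempty (TM2ComputableInPolyTime ea eb f) := by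
  have := Fintype.ofFinite K
  have := Fintype.ofFinite σ
  have := Fintype.ofFinite (Γ k₀)
  exact ⟨{
    tm := toFinTM2 p k₀ k₁ v₀
    inputAlphabet := e₀
    outputAlphabet := e₁
    time := time
    outputsFun := fun a =>
      ((nonempty_outputsInTime_iff (tm := toFinTM2 p k₀ k₁ v₀)).2 (h a)).some }⟩

end Bundled

end StackProgram

namespace StackProgram

open HDGInstance

/-! ### Programs with counters -/

section Counters

variable {K : Type} [DecidableEq K] {k aux out : K} {S : K → List Bool} {n T : ℕ}

/-- Push `true` on each stack of the list `ks`, then do `q`. -/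
def pushTrue (ks : List K) (q : Stmt (fun _ : K => Bool) Unit Bool) :
    Stmt (fun _ : K => Bool) Unit Bool :=
  ks.foldr (fun k => push k fun _ => true) q

theorem stepAux_pushTrue (ks : List K) (q : Stmt (fun _ : K => Bool) Unit Bool) (v : Bool)
    (S : K → List Bool) :
    stepAux (pushTrue ks q) v S = stepAux q v fun j => List.replicate (ks.count j) true ++ S j := by
  induction ks generalizing S with
  | nil => rfl
  | cons k ks ih =>
    refine (ih _).trans (congrArg _ (funext fun j => ?_))
    obtain rfl | h := eq_or_ne j k
    · simp [List.replicate_succ']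
    · simp [h, h.symm]

/-- Push the word `w` on the stack `k`; its first letter ends up on top. -/
def pushWord (k : K) (w : List Bool) : StackProgram (fun _ : K => Bool) Bool :=
  ofStmt (w.foldl (fun q b => push k (fun _ => b) q) halt)

theorem runs_pushWord (k : K) (w : List Bool) (v : Bool) (S : K → List Bool) :
    Runs (pushWord k w) v S v (Function.update S k (w ++ S k)) 1 := by
  have key (q : Stmt (fun _ : K => Bool) Unit Bool) :
      stepAux (w.foldl (fun q b => push k (fun _ => b) q) q) v S =
        stepAux q v (Function.update S k (w ++ S k)) := by
    induction w generalizing q with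
    | nil => simp
    | cons b w ih => simp [ih, stepAux]
  exact .ofStmt_halt (key halt)

/-- Pop an entry of the stack `k`; if there was one, do `q`. -/
def popThen (k : K) (q : Stmt (fun _ : K => Bool) Unit Bool) :
    Stmt (fun _ : K => Bool) Unit Bool :=
  pop k (fun _ a => a.isSome) (branch id (load (fun _ => false) q) halt)

theorem stepAux_popThen_of_eq_nil (h : S k = []) (q : Stmt (fun _ : K => Bool) Unit Bool)
    (v : Bool) : stepAux (popThen k q) v S = ⟨none, false, S⟩ := by
  have hS : Function.update S k [] = S := h ▸ Function.update_eq_self k S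
  simp [popThen, stepAux, h, hS]

theorem stepAux_popThen_of_eq_cons {b : Bool} {l : List Bool} (h : S k = b :: l)
    (q : Stmt (fun _ : K => Bool) Unit Bool) (v : Bool) :
    stepAux (popThen k q) v S = stepAux q false (Function.update S k l) := by
  simp [popThen, stepAux, h]

/-- Empty the stack `k`, and push a `true` on each stack of the list `ks` for each entry. -/
def pour (k : K) (ks : List K) : StackProgram (fun _ : K => Bool) Bool :=
  ofStmt (popThen k (pushTrue ks (goto fun _ => ())))

theorem runs_pour {ks : List K} (hk : k ∉ ks) (S : K → List Bool) :
    Runs (pour k ks) false S false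
      (fun j => if j = k then [] else List.replicate ((S k).length * ks.count j) true ++ S j)
      ((S k).length + 1) := by
  induction hl : S k generalizing S with
  | nil =>
    refine (Runs.ofStmt_halt (stepAux_popThen_of_eq_nil hl _ _)).of_eq_of_le ?_ (Nat.le_add_left ..)
    funext j
    split_ifs with hj
    · rw [hj, hl]
    · simp
  | cons b l ih =>
    refine Runs.ofStmt_goto ((stepAux_popThen_of_eq_cons hl _ _).trans (stepAux_pushTrue ..)) ?_
    refine (ih (fun j => List.replicate (ks.count j) true ++ Function.update S k l j)
      (by simp [List.count_eq_zero.2 hk])).of_eq_of_le (funext fun j => ?_) le_rfl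
    split_ifs with hj
    · rfl
    · rw [Function.update_of_ne hj, ← List.append_assoc, ← List.replicate_add, ← Nat.succ_mul]
      rfl

/-- Execute `p` once for each entry of the stack `k`, after having popped it. -/
def forEach (k : K) (p : StackProgram (fun _ : K => Bool) Bool) :
    StackProgram (fun _ : K => Bool) Bool :=
  loop (popThen k (goto fun _ => ())) p

theorem runs_forEach_of_eq_nil (p : StackProgram (fun _ : K => Bool) Bool) (h : S k = []) :
    Runs (forEach k p) false S false S 1 :=
  .loop_halt (stepAux_popThen_of_eq_nil h _ _)

theorem runs_forEach_of_eq_cons {p : StackProgram (fun _ : K => Bool) Bool} {b : Bool}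
    {l : List Bool} {S₁ S' : K → List Bool} {T₁ T₂ : ℕ} (h : S k = b :: l)
    (hp : Runs p false (Function.update S k l) false S₁ T₁)
    (hloop : Runs (forEach k p) false S₁ false S' T₂) :
    Runs (forEach k p) false S false S' (1 + T₁ + T₂) :=
  .loop_goto (stepAux_popThen_of_eq_cons h _ _) hp hloop

/-- Add the counter `k` to the counter `out`, by means of the empty stack `aux`. -/
def copy (k aux out : K) : StackProgram (fun _ : K => Bool) Bool :=
  seq (pour k [aux, out]) (pour aux [k])

theorem runs_copy (k aux out : K) (hk : S k = List.replicate n true) (hnil : S aux = [])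
    (haux : k ≠ aux := by decide) (hout : k ≠ out := by decide)
    (haux_out : aux ≠ out := by decide) :
    Runs (copy k aux out) false S false
      (Function.update S out (List.replicate n true ++ S out)) (2 * n + 2) := by
  refine ((runs_pour (by simp [haux, hout]) S).seq
    (runs_pour (by simp [haux.symm]) _)).of_eq_of_le ?_ (le_of_eq ?_)
  · funext j
    obtain rfl | hj := eq_or_ne j k
    · simp [haux, hout, haux.symm, haux_out, hk, hnil]
    obtain rfl | hj' := eq_or_ne j aux
    · simp [haux_out, hnil]
    obtain rfl | hj'' := eq_or_ne j out
    · simp [hj, hj', hj.symm, hj'.symm, hk]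
    · simp [hj, hj', hj'', hj.symm, hj'.symm, hj''.symm]
  · simp [haux.symm, haux_out.symm, hk, hnil]
    ring

/-- Write the unary code of the counter `k` to the stack `out`, using the empty stack `aux`. -/
def writeCounter (k aux out : K) : StackProgram (fun _ : K => Bool) Bool :=
  seq (pushWord out [false]) (copy k aux out)

theorem runs_writeCounter (k aux out : K) (hk : S k = List.replicate n true) (hnil : S aux = [])
    (haux : k ≠ aux := by decide) (hout : k ≠ out := by decide)
    (haux_out : aux ≠ out := by decide) :
    Runs (writeCounter k aux out) false S false
      (Function.update S out (encodeUnary n ++ S out)) (2 * n + 3) := by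
  refine ((runs_pushWord out [false] false S).seq (runs_copy (n := n) k aux out
    (by simpa [hout]) (by simpa [haux_out]) haux hout haux_out)).of_eq_of_le ?_ (le_of_eq ?_)
  · simp [encodeUnary]
  · ring

end Counters

/-! ### Evaluation of polynomials -/

/-- The stacks of the machine that writes instances: the input, four counters, the output. -/
inductive CounterStack
  | input | arg | value | factor | aux | output
  deriving DecidableEq

open CounterStack

instance : Fintype CounterStack :=
  ⟨{input, arg, value, factor, aux, output}, fun k => by cases k <;> decide⟩

/-- The contents of the stacks of the machine that writes instances. -/
def counterStacks (x : List Bool) (a b c d : ℕ) (o : List Bool) : CounterStack → List Bool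
  | input => x
  | arg => List.replicate a true
  | value => List.replicate b true
  | factor => List.replicate c true
  | aux => List.replicate d true
  | output => o

section CounterStacks

variable (x : List Bool) (a b c d n : ℕ) (o w : List Bool)

theorem update_counterStacks_value :
    Function.update (counterStacks x a b c d o) value
      (List.replicate n true ++ counterStacks x a b c d o value) =
        counterStacks x a (b + n) c d o := by
  funext j
  cases j <;> simp [counterStacks, List.replicate_append_replicate, add_comm]

theorem update_counterStacks_factor :
    Function.update (counterStacks x a b c d o) factor (List.replicate n true) =
      counterStacks x a b n d o := by
  funext j
  cases j <;> rfl

theorem update_counterStacks_aux :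
    Function.update (counterStacks x a b c d o) aux (List.replicate n true) =
      counterStacks x a b c n o := by
  funext j
  cases j <;> rfl

theorem update_counterStacks_output :
    Function.update (counterStacks x a b c d o) output w = counterStacks x a b c d w := by
  funext j
  cases j <;> rfl

/-- Add the product of the counters `arg` and `factor` to the counter `value`. -/
def addProduct : StackProgram (fun _ : CounterStack => Bool) Bool :=
  forEach factor (copy arg aux value)

theorem runs_addProduct :
    Runs addProduct false (counterStacks x a b c 0 o) false
      (counterStacks x a (b + c * a) 0 0 o) (c * (2 * a + 3) + 1) := by
  induction c generalizing b with
  | zero => exact (runs_forEach_of_eq_nil _ rfl).of_eq_of_le (by simp) (by simp)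
  | succ c ih =>
    have hcopy : Runs (copy arg aux value) false (counterStacks x a b c 0 o) false
        (counterStacks x a (b + a) c 0 o) (2 * a + 2) :=
      (runs_copy (n := a) arg aux value rfl rfl).of_eq_of_le (update_counterStacks_value ..) le_rfl
    rw [← update_counterStacks_factor x a b (c + 1) 0 c o] at hcopy
    refine (runs_forEach_of_eq_cons (k := factor) rfl hcopy (ih _)).of_eq_of_le ?_ (le_of_eq ?_)
    · rw [add_assoc, Nat.succ_mul, add_comm a]
    · ring

theorem exists_runs_eval (p : Polynomial ℕ) :
    ∃ (P : StackProgram (fun _ : CounterStack => Bool) Bool) (T : Polynomial ℕ), ∀ a : ℕ,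
      Runs P false (counterStacks [] a 0 0 0 []) false (counterStacks [] a (p.eval a) 0 0 [])
        (T.eval a) := by
  induction p using Polynomial.recOnHorner with
  | M0 => exact ⟨ofStmt halt, 1, fun a => by simpa using Runs.ofStmt_halt rfl⟩
  | MC p n _ _ ih =>
    obtain ⟨P, T, h⟩ := ih
    refine ⟨seq P (pushWord value (List.replicate n true)), T + 1, fun a => ?_⟩
    refine ((h a).seq (runs_pushWord value _ _ _)).of_eq_of_le ?_ (by simp)
    rw [update_counterStacks_value, Polynomial.eval_add, Polynomial.eval_C]
  | MX p _ ih =>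
    obtain ⟨P, T, h⟩ := ih
    refine ⟨seq P (seq (pour value [factor]) addProduct),
      T + ((p + 1) + (p * (2 * Polynomial.X + 3) + 1)), fun a => ?_⟩
    have hmove : Runs (pour value [factor]) false (counterStacks [] a (p.eval a) 0 0 []) false
        (counterStacks [] a 0 (p.eval a) 0 []) (p.eval a + 1) := by
      refine (runs_pour (by decide) _).of_eq_of_le (funext fun j => ?_) (by simp [counterStacks])
      cases j <;> simp [counterStacks]
    simpa using (h a).seq (hmove.seq (runs_addProduct [] a 0 (p.eval a) []))

/-! ### Writing instances -/

/-- The codes of `0, …, n - 1`. -/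
def encodeRange (n : ℕ) : List Bool := ((List.range n).map encodeUnary).flatten

theorem encodeRange_succ (n : ℕ) : encodeRange (n + 1) = encodeRange n ++ encodeUnary n := by
  simp [encodeRange, List.range_succ]

/-- Write the codes of the numbers below the counter `aux`. -/
def writeRange : StackProgram (fun _ : CounterStack => Bool) Bool :=
  forEach aux (writeCounter aux factor output)

theorem runs_writeRange :
    Runs writeRange false (counterStacks x a b 0 n o) false
      (counterStacks x a b 0 0 (encodeRange n ++ o)) (n * (2 * n + 4) + 1) := by
  induction n generalizing o with
  | zero => exact runs_forEach_of_eq_nil _ rfl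
  | succ n ih =>
    have hwrite : Runs (writeCounter aux factor output) false (counterStacks x a b 0 n o) false
        (counterStacks x a b 0 n (encodeUnary n ++ o)) (2 * n + 3) :=
      (runs_writeCounter (n := n) aux factor output rfl rfl).of_eq_of_le
        (update_counterStacks_output ..) le_rfl
    rw [← update_counterStacks_aux x a b 0 (n + 1) n o] at hwrite
    refine (runs_forEach_of_eq_cons (k := aux) rfl hwrite (ih _)).of_eq_of_le ?_ ?_
    · rw [encodeRange_succ, List.append_assoc]
    · ring_nf
      omega

/-- The code of an instance with `n` agents of different colors, without a bound on the sizes of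
coalitions, with at most three coalitions, at most `ρ` of them non-trivial. -/
def instanceCode (n ρ : ℕ) : List Bool :=
  encodeUnary n ++ encodeUnary n ++ encodeUnary n ++ encodeUnary 3 ++ encodeUnary ρ ++ encodeRange n

/-- Write the code of an instance whose number of agents is the counter `value`, starting from the
end; then empty the counters. -/
def writeInstance (ρ : ℕ) : StackProgram (fun _ : CounterStack => Bool) Bool :=
  seq (copy value factor aux) <| seq writeRange <|
  seq (pushWord output (encodeUnary 3 ++ encodeUnary ρ)) <|
  seq (writeCounter value aux output) <| seq (writeCounter value aux output) <|
  seq (writeCounter value aux output) <| seq (pour value []) (pour arg [])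

theorem runs_writeInstance (ρ : ℕ) :
    Runs (writeInstance ρ) false (counterStacks [] a n 0 0 []) false
      (counterStacks [] 0 0 0 0 (instanceCode n ρ)) (a + n * (2 * n + 13) + 20) := by
  have hcopy : Runs (copy value factor aux) false (counterStacks [] a n 0 0 []) false
      (counterStacks [] a n 0 n []) (2 * n + 2) :=
    (runs_copy (n := n) value factor aux rfl rfl).of_eq_of_le
      ((congrArg _ (List.append_nil _)).trans (update_counterStacks_aux ..)) le_rfl
  have hwrite (o : List Bool) : Runs (writeCounter value aux output) false
      (counterStacks [] a n 0 0 o) false (counterStacks [] a n 0 0 (encodeUnary n ++ o))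
      (2 * n + 3) :=
    (runs_writeCounter (n := n) value aux output rfl rfl).of_eq_of_le
      (update_counterStacks_output ..) le_rfl
  have hpush (o w : List Bool) : Runs (pushWord output w) false
      (counterStacks [] a n 0 0 o) false (counterStacks [] a n 0 0 (w ++ o)) 1 :=
    (runs_pushWord ..).of_eq_of_le (update_counterStacks_output ..) le_rfl
  have hvalue (o : List Bool) : Runs (pour value []) false (counterStacks [] a n 0 0 o) false
      (counterStacks [] a 0 0 0 o) (n + 1) := by
    refine (runs_pour (by simp) _).of_eq_of_le (funext fun j => ?_) (by simp [counterStacks])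
    cases j <;> simp [counterStacks]
  have harg (o : List Bool) : Runs (pour arg []) false (counterStacks [] a 0 0 0 o) false
      (counterStacks [] 0 0 0 0 o) (a + 1) := by
    refine (runs_pour (by simp) _).of_eq_of_le (funext fun j => ?_) (by simp [counterStacks])
    cases j <;> simp [counterStacks]
  refine (hcopy.seq <| (runs_writeRange ..).seq <| (hpush _ _).seq <| (hwrite _).seq <|
    (hwrite _).seq <| (hwrite _).seq <| (hvalue _).seq (harg _)).of_eq_of_le ?_ ?_
  · simp [instanceCode]
  · ring_nf
    omega

theorem exists_runs_instanceCode (p : Polynomial ℕ) (ρ : ℕ) :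
    ∃ (P : StackProgram (fun _ : CounterStack => Bool) Bool) (T : Polynomial ℕ), ∀ x : List Bool,
      Runs P false (single input x) false (single output (instanceCode (p.eval x.length) ρ))
        (T.eval x.length) := by
  obtain ⟨P, T, h⟩ := exists_runs_eval p
  refine ⟨seq (pour input [arg]) (seq P (writeInstance ρ)),
    (Polynomial.X + 1) + (T + (Polynomial.X + p * (2 * p + 13) + 20)), fun x => ?_⟩
  have hinput : Runs (pour input [arg]) false (single input x) false
      (counterStacks [] x.length 0 0 0 []) (x.length + 1) := by
    refine (runs_pour (by decide) _).of_eq_of_le (funext fun j => ?_) (by simp [single])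
    cases j <;> simp [counterStacks, single]
  have houtput (o : List Bool) :
      single (Γ := fun _ => Bool) output o = counterStacks [] 0 0 0 0 o := by
    funext j
    cases j <;> rfl
  rw [houtput]
  simpa using hinput.seq ((h _).seq (runs_writeInstance ..))

end CounterStacks

end StackProgram

namespace StackProgram

open HDGInstance

/-! ### The machine that answers preference queries -/

/-- The registers of the machine that answers queries: the symbol read last, the role of the agent,
the profiles of the coalition read last and of the one read before. -/
structure Registers where
  buffer : Option Bool
  role : Fin 4
  cur : Profile
  prev : Profile
  deriving DecidableEq, Fintype, Inhabited

/-- The stacks of the machine that answers queries, besides those of the verifier: the unread input,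
the word `x`, a second copy of it, the bits of a coalition. -/
inductive QueryStack
  | input | word | backup | bits
  deriving DecidableEq

open QueryStack

instance : Fintype QueryStack :=
  ⟨{input, word, backup, bits}, fun k => by cases k <;> decide⟩

/-- The contents of the stacks of the machine that answers queries. -/
def queryStacks (a b c d : List (Option Bool)) : QueryStack → List (Option Bool)
  | input => a
  | word => b
  | backup => c
  | bits => d

section QueryStacks

variable (a b c d l : List (Option Bool))

theorem update_queryStacks_input :
    Function.update (queryStacks a b c d) input l = queryStacks l b c d := by
  funext j
  cases j <;> rfl

theorem update_queryStacks_word :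
    Function.update (queryStacks a b c d) word l = queryStacks a l c d := by
  funext j
  cases j <;> rfl

theorem update_queryStacks_backup :
    Function.update (queryStacks a b c d) backup l = queryStacks a b l d := by
  funext j
  cases j <;> rfl

theorem update_queryStacks_bits :
    Function.update (queryStacks a b c d) bits l = queryStacks a b c l := by
  funext j
  cases j <;> rfl

end QueryStacks

/-- The alphabets of the machine that answers queries. -/
abbrev QueryAlphabet {K : Type} (Γ : K → Type) : K ⊕ QueryStack → Type :=
  SumAlphabet Γ fun _ : QueryStack => Option Bool

variable {K : Type} [DecidableEq K] {Γ : K → Type} {σ : Type}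

/-- Pop a symbol from the stack `k` and continue with `q`, depending on the symbol. An
empty stack is treated like a separator. -/
def readSymbol (k : QueryStack) (q : Option Bool → Stmt (QueryAlphabet Γ) Unit (σ × Registers)) :
    Stmt (QueryAlphabet Γ) Unit (σ × Registers) :=
  let forget (v : σ × Registers) := (v.1, { v.2 with buffer := none })
  pop (.inr k) (fun v a => (v.1, { v.2 with buffer := a.join })) <|
    branch (fun v => v.2.buffer == some true) (load forget (q (some true))) <|
    branch (fun v => v.2.buffer == some false) (load forget (q (some false))) <|
    load forget (q none)

variable {s : σ} {c : Fin 4} {f f' : Profile} {S : ∀ k, List (Γ k)}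
  {S₀ : QueryStack → List (Option Bool)}

theorem stepAux_readSymbol (k : QueryStack)
    (q : Option Bool → Stmt (QueryAlphabet Γ) Unit (σ × Registers)) :
    stepAux (readSymbol k q) (s, ⟨none, c, f, f'⟩) (join S S₀) =
      stepAux (q (S₀ k).head?.join) (s, ⟨none, c, f, f'⟩)
        (join S (Function.update S₀ k (S₀ k).tail)) := by
  rw [← update_join_inr]
  obtain h | h | h : (S₀ k).head?.join = none ∨ (S₀ k).head?.join = some true ∨
      (S₀ k).head?.join = some false := by
    rcases (S₀ k).head?.join with _ | _ | _ <;> simp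
  all_goals simp [readSymbol, stepAux, join, h]

/-- Read bits from the stack `k`, up to and including a separator, and execute `act` for each of
them and `q` at the end. -/
def scan (k : QueryStack)
    (act : Bool → Stmt (QueryAlphabet Γ) Unit (σ × Registers) →
      Stmt (QueryAlphabet Γ) Unit (σ × Registers))
    (q : Stmt (QueryAlphabet Γ) Unit (σ × Registers)) :
    StackProgram (QueryAlphabet Γ) (σ × Registers) :=
  ofStmt <| readSymbol k fun
    | some b => act b (goto fun _ => ())
    | none => q

theorem runs_scan_nil {k : QueryStack}
    {act : Bool → Stmt (QueryAlphabet Γ) Unit (σ × Registers) →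
      Stmt (QueryAlphabet Γ) Unit (σ × Registers)}
    {q : Stmt (QueryAlphabet Γ) Unit (σ × Registers)} {v' : σ × Registers}
    {S' : ∀ k, List (QueryAlphabet Γ k)} (hk : (S₀ k).head?.join = none)
    (hq : stepAux q (s, ⟨none, c, f, f'⟩) (join S (Function.update S₀ k (S₀ k).tail)) =
      ⟨none, v', S'⟩) :
    Runs (scan k act q) (s, ⟨none, c, f, f'⟩) (join S S₀) v' S' 1 := by
  refine .ofStmt_halt ((stepAux_readSymbol ..).trans ?_)
  rwa [hk]

theorem runs_scan_cons {k : QueryStack}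
    {act : Bool → Stmt (QueryAlphabet Γ) Unit (σ × Registers) →
      Stmt (QueryAlphabet Γ) Unit (σ × Registers)}
    {q : Stmt (QueryAlphabet Γ) Unit (σ × Registers)} {v₁ v' : σ × Registers}
    {S₁ S' : ∀ k, List (QueryAlphabet Γ k)} {T : ℕ} {b : Bool} {l : List (Option Bool)}
    (hk : S₀ k = some b :: l)
    (hact : stepAux (act b (goto fun _ => ())) (s, ⟨none, c, f, f'⟩)
      (join S (Function.update S₀ k l)) = ⟨some (), v₁, S₁⟩)
    (h : Runs (scan k act q) v₁ S₁ v' S' T) :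
    Runs (scan k act q) (s, ⟨none, c, f, f'⟩) (join S S₀) v' S' (T + 1) := by
  refine .ofStmt_goto ((stepAux_readSymbol ..).trans ?_) h
  rwa [hk]

/-- Move a word from the stack `k` to the stack `k'`, in reverse order. -/
def move (k k' : QueryStack) : StackProgram (QueryAlphabet Γ) (σ × Registers) :=
  scan k (fun b => push (.inr k') fun _ => some b) halt

theorem runs_move {k k' : QueryStack} (hkk' : k ≠ k') {x : List Bool} {l : List (Option Bool)}
    (hk : S₀ k = x.map some ++ l) (hl : l.head?.join = none) :
    Runs (move k k') (s, ⟨none, c, f, f'⟩) (join S S₀) (s, ⟨none, c, f, f'⟩)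
      (join S (Function.update (Function.update S₀ k' (x.reverse.map some ++ S₀ k')) k l.tail))
      (x.length + 1) := by
  induction x generalizing S₀ with
  | nil => exact runs_scan_nil (by rwa [hk]) (by simp [stepAux, hk])
  | cons b x ih =>
    refine runs_scan_cons hk (congrArg (Cfg.mk _ _) (update_join_inr ..))
      ((ih ?_).of_eq_of_le (congrArg _ ?_) le_rfl)
    · simp [hkk']
    · funext j
      obtain rfl | hj := eq_or_ne j k
      · simp
      obtain rfl | hj' := eq_or_ne j k'
      · simp [join, hj]
      · simp [hj, hj']

/-- Read the number of an agent, and remember its role. -/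
def readAgent : StackProgram (QueryAlphabet Γ) (σ × Registers) :=
  ofStmt <| readSymbol input fun
    | some true =>
      load (fun v => (v.1, { v.2 with role := roleOf (v.2.role + 1) })) (goto fun _ => ())
    | _ => readSymbol input fun _ => halt

theorem roleOf_roleOf_add_one (j : ℕ) : roleOf (roleOf j + 1) = roleOf (j + 1) := by
  ext
  simp only [roleOf]
  omega

theorem stepAux_readSymbol_input {a b d e : List (Option Bool)} {o : Option Bool}
    (q : Option Bool → Stmt (QueryAlphabet Γ) Unit (σ × Registers)) :
    stepAux (readSymbol input q) (s, ⟨none, c, f, f'⟩) (join S (queryStacks (o :: a) b d e)) =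
      stepAux (q o) (s, ⟨none, c, f, f'⟩) (join S (queryStacks a b d e)) := by
  rw [stepAux_readSymbol, update_queryStacks_input]
  rfl

theorem runs_readAgent (j i : ℕ) (a b d e : List (Option Bool)) :
    Runs readAgent (s, ⟨none, roleOf j, f, f'⟩)
      (join S (queryStacks ((encodeUnary i).map some ++ none :: a) b d e))
      (s, ⟨none, roleOf (j + i), f, f'⟩) (join S (queryStacks a b d e)) (i + 1) := by
  induction i generalizing j with
  | zero =>
    exact .ofStmt_halt ((stepAux_readSymbol_input _).trans (stepAux_readSymbol_input _))
  | succ i ih =>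
    have h := ih (j + 1)
    rw [← roleOf_roleOf_add_one, Nat.succ_add_eq_add_succ] at h
    exact .ofStmt_goto (stepAux_readSymbol_input _) h

/-- Read the bits of a coalition that are not about bit agents, and start a new profile. -/
def readHead : StackProgram (QueryAlphabet Γ) (σ × Registers) :=
  ofStmt <| readSymbol input fun a => readSymbol input fun b => readSymbol input fun c =>
    load (fun v => (v.1, { v.2 with
      cur := .ofWord (fun _ => false) (a == some true) (b == some true) (c == some true) []
      prev := v.2.cur })) halt

theorem runs_readHead (y₀ y₁ y₂ : Bool) (a b d e : List (Option Bool)) :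
    Runs readHead (s, ⟨none, c, f, f'⟩)
      (join S (queryStacks (some y₀ :: some y₁ :: some y₂ :: a) b d e))
      (s, ⟨none, c, .ofWord (fun _ => false) y₀ y₁ y₂ [], f⟩) (join S (queryStacks a b d e)) 1 := by
  refine .ofStmt_halt ?_
  simp only [stepAux_readSymbol_input, stepAux]
  simp

/-- Read the bit agents of a coalition, and complete its profile except for the acceptance. -/
def readBits : StackProgram (QueryAlphabet Γ) (σ × Registers) :=
  scan input (fun b q => push (.inr bits) (fun _ => some b) <| load (fun v => (v.1, { v.2 with
    cur := { v.2.cur with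
      anyBit := v.2.cur.anyBit || b
      allBits := v.2.cur.allBits && b } })) q) halt

theorem runs_readBits (r : List Bool) (a b d e : List (Option Bool)) (ha : a.head?.join = none) :
    Runs readBits (s, ⟨none, c, f, f'⟩) (join S (queryStacks (r.map some ++ a) b d e))
      (s, ⟨none, c, { f with
        anyBit := f.anyBit || r.any id
        allBits := f.allBits && r.all id }, f'⟩)
      (join S (queryStacks a.tail b d (r.reverse.map some ++ e))) (r.length + 1) := by
  induction r generalizing e f with
  | nil =>
    refine runs_scan_nil ha ?_
    rw [update_queryStacks_input]
    simp [stepAux, queryStacks]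
  | cons y r ih =>
    have h := ih (f := { f with anyBit := f.anyBit || y, allBits := f.allBits && y }) (some y :: e)
    simp only [Bool.or_assoc, Bool.and_assoc] at h
    refine runs_scan_cons rfl ?_ (h.of_eq_of_le (by simp) le_rfl)
    rw [update_queryStacks_input]
    exact congrArg (Cfg.mk _ _)
      ((update_join_inr ..).trans (congrArg _ (update_queryStacks_bits ..)))

/-- The certificate represented by a word: everything before the last `true`. -/
def certificate (r : List Bool) : List Bool := (r.rdropWhile (!·)).dropLast

theorem certificate_concat_true (r : List Bool) : certificate (r ++ [true]) = r := by
  rw [certificate, List.rdropWhile_concat_neg _ _ _ (by decide), List.dropLast_concat]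

theorem certificate_concat_false (r : List Bool) : certificate (r ++ [false]) = certificate r := by
  rw [certificate, List.rdropWhile_concat_pos _ _ _ rfl, certificate]

theorem length_certificate_le (r : List Bool) : (certificate r).length ≤ r.length - 1 := by
  rw [certificate, List.length_dropLast]
  exact Nat.sub_le_sub_right (List.rdropWhile_prefix ..).length_le 1

/-- Remove the last bits, up to and including the last `true`. -/
def strip : StackProgram (QueryAlphabet Γ) (σ × Registers) :=
  ofStmt <| readSymbol bits fun
    | some false => goto fun _ => ()
    | _ => halt

theorem runs_strip (r : List Bool) (a b d : List (Option Bool)) :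
    Runs strip (s, ⟨none, c, f, f'⟩) (join S (queryStacks a b d (r.reverse.map some)))
      (s, ⟨none, c, f, f'⟩) (join S (queryStacks a b d ((certificate r).reverse.map some)))
      (r.length + 1) := by
  have hread (o : Option Bool) (l : List (Option Bool))
      (q : Option Bool → Stmt (QueryAlphabet Γ) Unit (σ × Registers)) :
      stepAux (readSymbol bits q) (s, ⟨none, c, f, f'⟩) (join S (queryStacks a b d (o :: l))) =
        stepAux (q o) (s, ⟨none, c, f, f'⟩) (join S (queryStacks a b d l)) := by
    rw [stepAux_readSymbol, update_queryStacks_bits]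
    rfl
  induction r using List.reverseRecOn with
  | nil =>
    refine .ofStmt_halt ((stepAux_readSymbol ..).trans ?_)
    rw [update_queryStacks_bits]
    rfl
  | append_singleton r y ih =>
    rw [List.reverse_concat, List.length_append]
    cases y with
    | false =>
      rw [certificate_concat_false]
      exact .ofStmt_goto (hread _ _ _) ih
    | true =>
      rw [certificate_concat_true]
      exact (Runs.ofStmt_halt (hread _ _ _)).mono (Nat.le_add_left ..)

variable {k₀ k₁ : K} (e₀ : Γ k₀ ≃ Option Bool) (e₁ : Γ k₁ ≃ Bool)

theorem single_self (k : K) (l : List (Γ k)) : single k l k = l := Function.update_self ..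

theorem update_join_single (k : K) (l l' : List (Γ k)) :
    Function.update (join (single k l) S₀) (.inl k) l' = join (single k l') S₀ :=
  (update_join_inl ..).trans (congrArg (join · S₀) (Function.update_idem ..))

theorem update_join_single_cons (k : K) (l : List (Γ k)) (y : Γ k) :
    Function.update (join (single k l) S₀) (.inl k) (y :: join (single k l) S₀ (.inl k)) =
      join (single k (y :: l)) S₀ := by
  rw [update_join_single]
  exact congrArg (fun m => join (single k (y :: m)) S₀) (single_self k l)

/-- Write a separator and a certificate on the input stack of the verifier. -/
def writeCertificate : StackProgram (QueryAlphabet Γ) (σ × Registers) :=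
  scan bits (fun b => push (.inl k₀) fun _ => e₀.symm (some b))
    (push (.inl k₀) (fun _ => e₀.symm none) halt)

theorem runs_writeCertificate (w : List Bool) (l a b d : List (Option Bool)) :
    Runs (writeCertificate e₀) (s, ⟨none, c, f, f'⟩)
      (join (single k₀ (l.map e₀.symm)) (queryStacks a b d (w.map some))) (s, ⟨none, c, f, f'⟩)
      (join (single k₀ ((none :: (w.reverse.map some ++ l)).map e₀.symm)) (queryStacks a b d []))
      (w.length + 1) := by
  induction w generalizing l with
  | nil =>
    refine runs_scan_nil rfl ?_
    rw [update_queryStacks_bits]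
    exact congrArg (Cfg.mk _ _) (update_join_single_cons ..)
  | cons y w ih =>
    refine runs_scan_cons rfl ?_ ((ih (some y :: l)).of_eq_of_le (by simp) le_rfl)
    rw [update_queryStacks_bits]
    exact congrArg (Cfg.mk _ _) (update_join_single_cons ..)

/-- Write a word on the input stack of the verifier, and keep a copy. -/
def writeWord : StackProgram (QueryAlphabet Γ) (σ × Registers) :=
  scan word (fun b q => push (.inl k₀) (fun _ => e₀.symm (some b)) <|
    push (.inr backup) (fun _ => some b) q) halt

theorem runs_writeWord (x : List Bool) (l a d e : List (Option Bool)) :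
    Runs (writeWord e₀) (s, ⟨none, c, f, f'⟩)
      (join (single k₀ (l.map e₀.symm)) (queryStacks a (x.map some) d e)) (s, ⟨none, c, f, f'⟩)
      (join (single k₀ ((x.reverse.map some ++ l).map e₀.symm))
        (queryStacks a [] (x.reverse.map some ++ d) e)) (x.length + 1) := by
  induction x generalizing l d with
  | nil =>
    refine runs_scan_nil rfl ?_
    rw [update_queryStacks_word]
    rfl
  | cons y x ih =>
    refine runs_scan_cons rfl ?_ ((ih (some y :: l) (some y :: d)).of_eq_of_le (by simp) le_rfl)
    rw [update_queryStacks_word]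
    simp only [stepAux]
    rw [update_join_single_cons, update_join_inr, update_queryStacks_backup]
    rfl

/-- Read the answer of the verifier. -/
def readAnswer : StackProgram (QueryAlphabet Γ) (σ × Registers) :=
  ofStmt <| pop (.inl k₁) (fun v a => (v.1, { v.2 with
    cur := { v.2.cur with accepted := a.map e₁ == some true } })) halt

theorem runs_readAnswer (y : Bool) :
    Runs (readAnswer e₁) (s, ⟨none, c, f, f'⟩) (join (single k₁ [e₁.symm y]) S₀)
      (s, ⟨none, c, { f with accepted := y }, f'⟩) (join (single k₁ []) S₀) 1 :=
  .ofStmt_halt (by simp [stepAux, join, single_self, update_join_single])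

/-- Let `answer` determine the answer to a query, clean up, and write the answer. -/
def writeAnswer (v₀ : σ × Registers) (answer : Fin 4 → Profile → Profile → Bool) :
    StackProgram (QueryAlphabet Γ) (σ × Registers) :=
  scan word (fun _ q => q) <|
    push (.inl k₁) (fun v => e₁.symm (answer v.2.role v.2.prev v.2.cur)) <|
    load (fun _ => v₀) halt

theorem runs_writeAnswer (v₀ : σ × Registers) (answer : Fin 4 → Profile → Profile → Bool)
    (x : List Bool) (a d e : List (Option Bool)) :
    Runs (writeAnswer e₁ v₀ answer) (s, ⟨none, c, f, f'⟩)
      (join (single k₁ []) (queryStacks a (x.map some) d e)) v₀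
      (join (single k₁ [e₁.symm (answer c f' f)]) (queryStacks a [] d e)) (x.length + 1) := by
  induction x with
  | nil =>
    refine runs_scan_nil rfl ?_
    rw [update_queryStacks_word]
    exact congrArg (Cfg.mk _ _) (update_join_single_cons ..)
  | cons y x ih =>
    refine runs_scan_cons rfl ?_ ih
    rw [update_queryStacks_word]
    rfl

/-- Started in the state `s`, the program `p` halts in the state `s` and decides `V` on the codes of
pairs of words in time `T`. The input and output alphabets are encoded by `e₀` and `e₁`. -/
def Verifies (p : StackProgram Γ σ) (s : σ) (V : List Bool × List Bool → Bool) (T : ℕ → ℕ) : Prop :=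
  ∀ x w, Runs p s (single k₀ ((encodePair (x, w)).map e₀.symm)) s
    (single k₁ [e₁.symm (V (x, w))]) (T (encodePair (x, w)).length)

/-- Let the verifier `p` decide on the acceptance of the coalition read last. -/
def consult (p : StackProgram Γ σ) : StackProgram (QueryAlphabet Γ) (σ × Registers) :=
  seq strip <| seq (writeCertificate e₀) <| seq (writeWord e₀) <| seq (move backup word) <|
    seq (lift _ _ p) (readAnswer e₁)

/-- Read a coalition and compute its profile. -/
def examine (p : StackProgram Γ σ) : StackProgram (QueryAlphabet Γ) (σ × Registers) :=
  seq readHead <| seq readBits (consult e₀ e₁ p)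

/-- Answer a query, where the preferences between coalitions are given by `answer` in terms of the
role of the agent and the profiles of the coalitions. -/
def answerQuery (p : StackProgram Γ σ) (s : σ) (answer : Fin 4 → Profile → Profile → Bool) :
    StackProgram (QueryAlphabet Γ) (σ × Registers) :=
  seq (move input word) <| seq readAgent <| seq (examine e₀ e₁ p) <| seq (examine e₀ e₁ p) <|
    writeAnswer e₁ (s, default) answer

variable {e₀ e₁} {p : StackProgram Γ σ} {V : List Bool × List Bool → Bool} {T : ℕ → ℕ} {m : ℕ}

theorem single_nil (k k' : K) : (single k [] : ∀ j, List (Γ j)) = single k' [] := by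
  simp only [single, Function.update_eq_self_iff.2]

theorem runs_consult (hp : Verifies e₀ e₁ p s V T) (hT : Monotone T) (x r : List Bool)
    (a : List (Option Bool)) :
    Runs (consult e₀ e₁ p) (s, ⟨none, c, f, f'⟩)
      (join (single k₀ []) (queryStacks a (x.reverse.map some) [] (r.reverse.map some)))
      (s, ⟨none, c, { f with accepted := V (x, certificate r) }, f'⟩)
      (join (single k₀ []) (queryStacks a (x.reverse.map some) [] []))
      (T (x.length + r.length + 1) + 2 * x.length + 2 * r.length + 5) := by
  have hcert := runs_writeCertificate (s := s) (c := c) (f := f) (f' := f') e₀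
    (certificate r).reverse [] a (x.reverse.map some) []
  have hword := runs_writeWord (s := s) (c := c) (f := f) (f' := f') e₀ x.reverse
    (none :: ((certificate r).reverse.reverse.map some ++ [])) a [] []
  have hmove : Runs (move backup word) (s, ⟨none, c, f, f'⟩)
      (join (single k₀ ((encodePair (x, certificate r)).map e₀.symm))
        (queryStacks a [] (x.reverse.reverse.map some ++ []) [])) (s, ⟨none, c, f, f'⟩)
      (join (single k₀ ((encodePair (x, certificate r)).map e₀.symm))
        (queryStacks a (x.reverse.map some) [] [])) (x.length + 1) := by
    refine (runs_move (x := x) (l := []) (by decide) ?_ rfl).of_eq_of_le (congrArg _ ?_) le_rfl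
    · simp [queryStacks]
    · rw [update_queryStacks_word, update_queryStacks_backup]
      simp [queryStacks]
  have hverify := (hp x (certificate r)).lift (⟨none, c, f, f'⟩ : Registers)
    (queryStacks a (x.reverse.map some) [] [])
  have hanswer := runs_readAnswer (s := s) (c := c) (f := f) (f' := f') e₁ (V (x, certificate r))
    (S₀ := queryStacks a (x.reverse.map some) [] [])
  rw [single_nil k₁ k₀] at hanswer
  have hpair : x.reverse.reverse.map some ++
      none :: ((certificate r).reverse.reverse.map some ++ []) = encodePair (x, certificate r) := by
    simp [encodePair]
  rw [hpair] at hword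
  refine ((runs_strip ..).seq <| hcert.seq <| hword.seq <| hmove.seq <|
    hverify.seq hanswer).mono ?_
  have hcertLength := length_certificate_le r
  have hlength : (encodePair (x, certificate r)).length ≤ x.length + r.length + 1 := by
    simp only [encodePair, List.length_append, List.length_map, List.length_cons]
    omega
  have hverifyTime := hT hlength
  simp only [List.length_reverse]
  omega

theorem ofFn_decide_mem (X : Finset (Fin (m + 3))) : List.ofFn (fun i => decide (i ∈ X)) =
    decide (0 ∈ X) :: decide (1 ∈ X) :: decide (2 ∈ X) :: bitsOf X := by
  rw [List.ofFn_succ, List.ofFn_succ, List.ofFn_succ]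
  rfl

theorem runs_examine (hp : Verifies e₀ e₁ p s V T) (hT : Monotone T) (x : List Bool)
    (X : Finset (Fin (m + 3))) {a : List (Option Bool)} (ha : a.head?.join = none) :
    Runs (examine e₀ e₁ p) (s, ⟨none, c, f, f'⟩)
      (join (single k₀ []) (queryStacks ((List.ofFn fun i => decide (i ∈ X)).map some ++ a)
        (x.reverse.map some) [] []))
      (s, ⟨none, c, .ofCoalition (fun r => V (x, certificate r)) X, f⟩)
      (join (single k₀ []) (queryStacks a.tail (x.reverse.map some) [] []))
      (T (x.length + m + 1) + 2 * x.length + 3 * m + 7) := by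
  have hlength : (bitsOf X).length = m := List.length_ofFn
  have hconsult := runs_consult (c := c) (f' := f)
    (f := .ofWord (fun _ => false) (decide (0 ∈ X)) (decide (1 ∈ X)) (decide (2 ∈ X)) (bitsOf X))
    hp hT x (bitsOf X) a.tail
  have hbits := runs_readBits (Γ := Γ) (S := single k₀ []) (s := s) (c := c) (f' := f)
    (f := .ofWord (fun _ => false) (decide (0 ∈ X)) (decide (1 ∈ X)) (decide (2 ∈ X)) [])
    (bitsOf X) a (x.reverse.map some) [] [] ha
  rw [List.append_nil] at hbits
  rw [ofFn_decide_mem]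
  refine ((runs_readHead ..).seq <| hbits.seq hconsult).mono ?_
  rw [hlength]
  omega

theorem single_input_eq_join (k : K) (l : List (Option Bool)) :
    single (Γ := QueryAlphabet Γ) (.inr input) l = join (single k []) (queryStacks l [] [] []) := by
  have h : (fun _ => []) = join (single k ([] : List (Γ k))) (queryStacks [] [] [] []) := by
    funext j
    rcases j with j | _ | _ <;> simp [join, single, queryStacks]
  rw [single, h, update_join_inr, update_queryStacks_input]

theorem join_single_queryStacks_nil (k : K) (l : List (Γ k)) :
    join (single k l) (queryStacks [] [] [] []) = single (Γ := QueryAlphabet Γ) (.inl k) l := by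
  have h : (fun _ => []) = join (fun j => ([] : List (Γ j))) (queryStacks [] [] [] []) := by
    funext j
    rcases j with j | _ | _ <;> rfl
  exact (update_join_inl ..).symm.trans (congrArg (Function.update · _ _) h.symm)

theorem runs_answerQuery (hp : Verifies e₀ e₁ p s V T) (hT : Monotone T)
    (answer : Fin 4 → Profile → Profile → Bool) (x : List Bool) (i : Fin (m + 3))
    (X Y : Finset (Fin (m + 3))) :
    Runs (answerQuery e₀ e₁ p s answer) (s, default)
      (single (Γ := QueryAlphabet Γ) (.inr input) (x.map some ++ none ::
        ((encodeUnary i).map some ++ none :: (List.ofFn fun j => decide (j ∈ X)).map some ++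
          none :: (List.ofFn fun j => decide (j ∈ Y)).map some)))
      (s, default)
      (single (Γ := QueryAlphabet Γ) (.inl k₁)
        [e₁.symm (answer (roleOf i) (.ofCoalition (fun r => V (x, certificate r)) X)
          (.ofCoalition (fun r => V (x, certificate r)) Y))])
      (2 * T (x.length + m + 1) + 6 * x.length + i + 6 * m + 17) := by
  set code : Finset (Fin (m + 3)) → List (Option Bool) :=
    fun Z => (List.ofFn fun j => decide (j ∈ Z)).map some
  have hmove : Runs (Γ := QueryAlphabet Γ) (move input word) (s, default)
      (join (single k₀ []) (queryStacks (x.map some ++ none ::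
        ((encodeUnary i).map some ++ none :: code X ++ none :: code Y)) [] [] [])) (s, default)
      (join (single k₀ []) (queryStacks ((encodeUnary i).map some ++ none ::
        (code X ++ none :: code Y)) (x.reverse.map some) [] [])) (x.length + 1) := by
    refine (runs_move (by decide) rfl rfl).of_eq_of_le (congrArg _ ?_) le_rfl
    rw [update_queryStacks_word, update_queryStacks_input]
    simp [queryStacks]
  have hagent := runs_readAgent (Γ := Γ) (S := single k₀ []) (s := s) (f := default) (f' := default)
    0 i (code X ++ none :: code Y) (x.reverse.map some) [] []
  rw [zero_add] at hagent
  set profile : Finset (Fin (m + 3)) → Profile := .ofCoalition fun r => V (x, certificate r)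
  have hX := runs_examine (c := roleOf i) (f := default) (f' := default) hp hT x X
    (a := none :: code Y) rfl
  have hY := runs_examine (c := roleOf i) (f := profile X) (f' := default) hp hT x Y (a := []) rfl
  rw [List.append_nil] at hY
  have hwrite := runs_writeAnswer (s := s) (c := roleOf i) (f := profile Y) (f' := profile X)
    e₁ (s, default) answer x.reverse [] [] []
  rw [single_nil k₁ k₀, join_single_queryStacks_nil] at hwrite
  rw [single_input_eq_join k₀]
  refine (hmove.seq <| hagent.seq <| hX.seq <| hY.seq hwrite).mono ?_
  rw [List.length_reverse]
  omega

end StackProgram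

/-! ### The reduction -/

open StackProgram HDGInstance

namespace certificateGame

theorem encode_eq (τ m : ℕ) (acc : List Bool → Bool) (ρ : ℕ) :
    (certificateGame τ m acc ρ).encode = instanceCode (m + 3) ρ := by
  have hcolors :
      (List.ofFn fun i : Fin (m + 3) => encodeUnary i).flatten = encodeRange (m + 3) := by
    rw [encodeRange, ← List.map_coe_finRange_eq_range, List.map_map, List.ofFn_eq_map]
    rfl
  rw [instanceCode, ← hcolors]
  rfl

/-- Does an agent with role `c` weakly prefer a coalition with profile `f` to one with `g`? -/
def prefers (τ : ℕ) (c : Fin 4) (f g : Profile) : Bool :=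
  decide ((AgentType.assign τ c).approves g ≤ (AgentType.assign τ c).approves f)

theorem oracle_eq {τ m : ℕ} {acc : List Bool → Bool} {ρ : ℕ}
    (q : (certificateGame τ m acc ρ).Query) :
    (certificateGame τ m acc ρ).oracle q =
      prefers τ (roleOf (Fin.val q.1)) (.ofCoalition acc q.2.1.1) (.ofCoalition acc q.2.2.1) :=
  decide_eq_decide.2 (rainbowGame.weakPref_iff ..)

theorem length_encodeQuery {τ m : ℕ} {acc : List Bool → Bool} {ρ : ℕ}
    (q : (certificateGame τ m acc ρ).Query) :
    ((certificateGame τ m acc ρ).encodeQuery q).length = Fin.val q.1 + 2 * m + 9 := by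
  have hset (C) : ((certificateGame τ m acc ρ).encodeSet C).length = m + 3 := List.length_ofFn
  simp only [encodeQuery, encodeUnary, List.length_append, List.length_map, List.length_cons,
    List.length_replicate, List.length_nil, hset]
  omega

end certificateGame

theorem polynomial_eval_monotone (p : Polynomial ℕ) : Monotone fun n => p.eval n := by
  intro a b h
  simp only [Polynomial.eval_eq_sum_range]
  gcongr

theorem exists_certificate_eq {w : List Bool} {b : ℕ} (hw : w.length ≤ b) :
    ∃ r : List Bool, r.length = b + 1 ∧ r.any id = true ∧ certificate r = w := by
  induction b, hw using Nat.le_induction with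
  | base => exact ⟨w ++ [true], by simp, by simp, certificate_concat_true w⟩
  | succ b _ ih =>
    obtain ⟨r, hlength, hany, rfl⟩ := ih
    exact ⟨r ++ [false], by simp [hlength], by simp [hany], certificate_concat_false r⟩

theorem exists_certificate_iff_exists_word (V : List Bool → Bool) (b : ℕ) :
    (∃ r : List Bool, r.length = b + 1 ∧ r.any id = true ∧ V (certificate r) = true) ↔
      ∃ w : List Bool, w.length ≤ b ∧ V w = true := by
  constructor
  · rintro ⟨r, hr, -, h⟩
    exact ⟨certificate r, (length_certificate_le r).trans_eq (by rw [hr, Nat.add_sub_cancel]), h⟩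
  · rintro ⟨w, hw, h⟩
    obtain ⟨r, hr, hany, rfl⟩ := exists_certificate_eq hw
    exact ⟨r, hr, hany, h⟩

/-- The certificate game for the word `x`, where `V` is a verifier, and `b` bounds the lengths of
certificates. -/
def reduction (τ ρ : ℕ) (V : List Bool × List Bool → Bool) (b : Polynomial ℕ) (x : List Bool) :
    HDGInstance :=
  certificateGame τ (b.eval x.length + 1) (fun r => V (x, certificate r)) ρ

section Reduction

variable (τ ρ : ℕ) {V : List Bool × List Bool → Bool} (b : Polynomial ℕ)

theorem computable_encode_reduction (V : List Bool × List Bool → Bool) :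
    Nonempty (TM2ComputableInPolyTime id encode (reduction τ ρ V b)) := by
  obtain ⟨P, T, h⟩ := exists_runs_instanceCode (b + 4) ρ
  refine computableInPolyTime_of_runs P .input .output false (.refl Bool) (.refl Bool) T fun x => ?_
  simpa [reduction, certificateGame.encode_eq, add_assoc] using h x

theorem computable_oracle_reduction
    (hV : Nonempty (TM2ComputableInPolyTime encodePair (fun y : Bool => [y]) V)) :
    Nonempty (TM2ComputableInPolyTime
      (fun a : Σ x, (reduction τ ρ V b x).Query =>
        a.1.map some ++ none :: (reduction τ ρ V b a.1).encodeQuery a.2)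
      (fun y : Bool => [y]) fun a => (reduction τ ρ V b a.1).oracle a.2) := by
  obtain ⟨hV⟩ := hV
  have hverifies : Verifies hV.inputAlphabet hV.outputAlphabet (ofFinTM2 hV.tm) hV.tm.initialState
      V fun n => hV.time.eval n :=
    fun x w => nonempty_outputsInTime_iff.1 ⟨hV.outputsFun (x, w)⟩
  have := hV.tm.kFin
  have := hV.tm.σFin
  refine computableInPolyTime_of_runs (Γ := QueryAlphabet hV.tm.Γ)
    (answerQuery hV.inputAlphabet hV.outputAlphabet (ofFinTM2 hV.tm) hV.tm.initialState
      (certificateGame.prefers τ)) (.inr .input) (.inl hV.tm.k₁) (hV.tm.initialState, default)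
    (.refl _) hV.outputAlphabet (2 * hV.time + 12 * .X + 17) ?_
  rintro ⟨x, q⟩
  have hquery := runs_answerQuery hverifies (polynomial_eval_monotone hV.time)
    (certificateGame.prefers τ) x q.1 q.2.1.1 q.2.2.1
  rw [← certificateGame.oracle_eq q (ρ := ρ)] at hquery
  rw [Equiv.refl_symm, Equiv.coe_refl, List.map_id]
  refine hquery.mono ?_
  have hlength : (x.map some ++ none :: (reduction τ ρ V b x).encodeQuery q).length =
      x.length + (Fin.val q.1 + 2 * (b.eval x.length + 1) + 9 + 1) := by
    rw [List.length_append, List.length_map, List.length_cons]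
    exact congrArg (fun l => x.length + (l + 1)) (certificateGame.length_encodeQuery q)
  have htime : hV.time.eval (x.length + (b.eval x.length + 1) + 1) ≤ hV.time.eval
      (x.map some ++ none :: (reduction τ ρ V b x).encodeQuery q).length :=
    polynomial_eval_monotone hV.time (by omega)
  simp only [Polynomial.eval_add, Polynomial.eval_mul, Polynomial.eval_X, Polynomial.eval_ofNat]
  omega

end Reduction

theorem mainTheorem8_general {Yes : HDGInstance → Prop}
    (hNash : ∀ I : HDGInstance, I.NashYes → Yes I)
    (hRational : ∀ I : HDGInstance, Yes I → I.RationalYes)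
    {τ ρ : ℕ} (h₂ : 2 ≤ τ) (h₄ : τ ≤ 4) (hρ : 2 ≤ ρ) :
    NPHardRestricted Yes
      (fun I => I.numTypes = τ ∧ I.maxNontrivial = ρ ∧ I.maxCoalitions = 3) := by
  rintro L ⟨b, V, hV, hL⟩
  refine ⟨reduction τ ρ V b,
    ⟨computable_encode_reduction τ ρ b V, computable_oracle_reduction τ ρ b hV⟩,
    fun x => ⟨certificateGame.numTypes_eq (Nat.succ_pos _) h₂ h₄, rfl, rfl⟩, fun x => ?_⟩
  rw [hL, ← exists_certificate_iff_exists_word fun w => V (x, w)]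
  constructor
  · rintro ⟨r, hlength, hany, hacc⟩
    refine hNash _ ?_
    rw [reduction, ← hlength]
    exact certificateGame.nashYes hρ hany hacc
  · exact fun h => certificateGame.exists_accepted_of_rationalYes (Nat.succ_pos _) (hRational _ h)

theorem mainTheorem8 :
    NPHardRestricted HDGInstance.NashYes
      (fun I => I.numTypes = 2 ∧ I.maxNontrivial = 2 ∧ I.maxCoalitions = 3) ∧
    NPHardRestricted HDGInstance.IndividualYes
      (fun I => I.numTypes = 4 ∧ I.maxNontrivial = 3 ∧ I.maxCoalitions = 3) :=
  ⟨mainTheorem8_general (fun _ => id) (fun _ h => h.individualYes.rationalYes)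
      le_rfl (by decide) le_rfl,
    mainTheorem8_general (fun _ => NashYes.individualYes) (fun _ => IndividualYes.rationalYes)
      (by decide) le_rfl (by decide)⟩
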